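/- A Boolean circuit $X:\{0,1\}^n\to\{0,1\}^m$ encodes the distribution of $X(r)$ for uniformly random $r\in\{0,1\}^n$. For two circuits $X,Y:\{0,1\}^n\to\{0,1\}^m$ let $$SD(X,Y)=\tfrac12\sum_{y\in\{0,1\}^m}\bigl|\Pr_r[X(r)=y]-\Pr_r[Y(r)=y]\bigr|,$$ $$Disj(X,Y)=2^{-n}\,\bigl|\{i\in\{0,1\}^n:\ X(i)\neq Y(j)\text{ for all }j\in\{0,1\}^n\}\bigr|,$$ and $\textrm{mut-}Disj(X,Y)=\min(Disj(X,Y),Disj(Y,X))$. For real numbers $\alpha,\beta$, let $\textrm{mut-}IID^{\alpha,\beta}$ be the promise problem whose instances are pairs $(X,Y)$ of circuits with the same number of inputs and the same number of outputs (given by their descriptions), whose Yes instances are the pairs with $SD(X,Y)\le\alpha$, and whose No instances are the pairs with $\textrm{mut-}Disj(X,Y)\ge\beta$. A promise problem $\Pi$ reduces to $\Omega$, written $\Pi\preccurlyeq\Omega$, if there is a polynomial-time computable function that maps Yes instances of $\Pi$ to Yes instances of $\Omega$ and No instances of $\Pi$ to No instances of $\Omega$. **Proposition (polarization).** Let $a<b$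 be real constants. Then $$\textrm{mut-}IID^{a,b}\ \preccurlyeq\ \textrm{mut-}IID^{2^{-k},\,1-2^{-k}}\qquad\text{for every } k\in\mathbb N,$$ and this holds uniformly in $k$: there is a function $f$ (depending only on $a,b$), computable in time polynomial in the length of its input $(X,Y,1^k)$, such that for all $k\in\mathbb N$ and all pairs $(X,Y)$, with $(A,B)=f(X,Y,1^k)$, $$SD(X,Y)\le a\ \Rightarrow\ SD(A,B)\le 2^{-k},\qquad \textrm{mut-}Disj(X,Y)\ge b\ \Rightarrow\ \textrm{mut-}Disj(A,B)\ge 1-2^{-k}.$$ -/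

import Mathlib

/-! ### Boolean circuits -/

/-- A node of a Boolean circuit with input variables `x_0, …, x_{n-1}`: an input variable, a
constant, or a gate that reads the values of the nodes with the given positions. -/
inductive Node (n : ℕ) : Type
  | var (i : Fin n)
  | const (c : Bool)
  | not (p : ℕ)
  | and (p q : ℕ)
  | or (p q : ℕ)

namespace Node

/-- The positions of the nodes that a node reads. -/
def preds {n : ℕ} : Node n → List ℕ
  | var _ => []
  | const _ => []
  | not p => [p]
  | and p q => [p, q]
  | or p q => [p, q]

/-- The value of a node on input `x`, where `v` lists the values of the earlier nodes. -/
def eval {n : ℕ} (x : Fin n → Bool) (v : List Bool) : Node n → Bool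
  | var i => x i
  | const c => c
  | not p => !(v.getD p false)
  | and p q => v.getD p false && v.getD q false
  | or p q => v.getD p false || v.getD q false

end Node

/-- A Boolean circuit with `n` inputs and `m` outputs: a topologically ordered list of nodes,
each of which reads only earlier nodes, and a choice of `m` output nodes. -/
structure Circuit (n m : ℕ) where
  nodes : List (Node n)
  outputs : Fin m → ℕ
  preds_lt : ∀ (j : ℕ) (hj : j < nodes.length), ∀ p ∈ (nodes[j]).preds, p < j
  outputs_lt : ∀ o, outputs o < nodes.length

namespace Circuit

/-- The values of all nodes, in order, on input `x`. -/
def values {n m : ℕ} (C : Circuit n m) (x : Fin n → Bool) : List Bool :=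
  C.nodes.foldl (fun v g => v ++ [g.eval x v]) []

/-- The function `{0,1}^n → {0,1}^m` that the circuit computes. -/
def eval {n m : ℕ} (C : Circuit n m) (x : Fin n → Bool) : Fin m → Bool :=
  fun o => (C.values x).getD (C.outputs o) false

/-- The distribution encoded by a circuit: the probability of the output `y` on a uniformly
random input. -/
noncomputable def prob {n m : ℕ} (C : Circuit n m) (y : Fin m → Bool) : ℝ :=
  ((Finset.univ.filter fun x : Fin n → Bool => C.eval x = y).card : ℝ) / 2 ^ n

end Circuit

/-! ### Statistical difference and disjointness -/

/-- The statistical difference of the encoded distributions. -/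
noncomputable def SD {n m : ℕ} (X Y : Circuit n m) : ℝ :=
  (1 / 2) * ∑ y : Fin m → Bool, |X.prob y - Y.prob y|

/-- The fraction of the inputs of `X` whose output is not in the image of `Y`. -/
noncomputable def Disj {n m : ℕ} (X Y : Circuit n m) : ℝ :=
  ((Finset.univ.filter fun i : Fin n → Bool =>
    ∀ j : Fin n → Bool, X.eval i ≠ Y.eval j).card : ℝ) / 2 ^ n

/-- The mutual disjointness. -/
noncomputable def mutDisj {n m : ℕ} (X Y : Circuit n m) : ℝ :=
  min (Disj X Y) (Disj Y X)

/-! ### Promise problems -/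

/-- A promise problem, given by its Yes instances and its No instances. (For `mutIID a b` these
are disjoint whenever `a < b`, see `mutIID_disjoint`.) -/
structure PromiseProblem (α : Type) where
  yes : Set α
  no : Set α

/-- A pair of circuits with the same number of inputs and the same number of outputs. -/
structure CircuitPair where
  n : ℕ
  m : ℕ
  X : Circuit n m
  Y : Circuit n m

/-- The problem mut-IID with parameters `a` and `b`. -/
def mutIID (a b : ℝ) : PromiseProblem CircuitPair where
  yes := {P | SD P.X P.Y ≤ a}
  no := {P | b ≤ mutDisj P.X P.Y}

theorem Disj_le_SD {n m : ℕ} (X Y : Circuit n m) : Disj X Y ≤ SD X Y := by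
  classical
  have sum_prob : ∀ C : Circuit n m, ∑ y, C.prob y = 1 := by
    intro C
    unfold Circuit.prob
    rw [← Finset.sum_div, ← Nat.cast_sum, ← Finset.card_eq_sum_card_fiberwise]
    · simp
    · intro x _; simp
  set S : Finset (Fin m → Bool) := Finset.univ.filter fun y => ∀ j, y ≠ Y.eval j with hS
  have hY : ∀ y ∈ S, Y.prob y = 0 := by
    intro y hy
    simp only [hS, Finset.mem_filter, Finset.mem_univ, true_and] at hy
    simp only [Circuit.prob, div_eq_zero_iff, Nat.cast_eq_zero, Finset.card_eq_zero]
    left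
    ext x
    simpa using fun h => hy x h.symm
  have hD : Disj X Y = ∑ y ∈ S, X.prob y := by
    unfold Disj Circuit.prob
    rw [← Finset.sum_div, ← Nat.cast_sum]
    congr 2
    rw [Finset.card_eq_sum_card_fiberwise (f := X.eval) (t := S)]
    · refine Finset.sum_congr rfl fun y hy => ?_
      congr 1
      ext x
      simp only [hS, Finset.mem_filter, Finset.mem_univ, true_and] at hy ⊢
      constructor
      · exact fun h => h.2
      · rintro rfl; exact ⟨hy, rfl⟩
    · intro x hx; simpa [hS] using hx
  have h1 : Disj X Y = ∑ y ∈ S, (X.prob y - Y.prob y) := by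
    rw [hD]
    exact Finset.sum_congr rfl fun y hy => by rw [hY y hy, sub_zero]
  have h2 : ∑ y ∈ S, (X.prob y - Y.prob y) ≤ ∑ y ∈ S, |X.prob y - Y.prob y| :=
    Finset.sum_le_sum fun y _ => le_abs_self _
  have h3 : -∑ y ∈ Sᶜ, (X.prob y - Y.prob y) ≤ ∑ y ∈ Sᶜ, |X.prob y - Y.prob y| := by
    rw [← Finset.sum_neg_distrib]
    exact Finset.sum_le_sum fun y _ => neg_le_abs _
  have h4 := Finset.sum_add_sum_compl S fun y => X.prob y - Y.prob y
  have h5 := Finset.sum_add_sum_compl S fun y => |X.prob y - Y.prob y|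
  have h6 : ∑ y, (X.prob y - Y.prob y) = 0 := by
    rw [Finset.sum_sub_distrib, sum_prob, sum_prob, sub_self]
  unfold SD
  linarith

theorem mutIID_disjoint {a b : ℝ} (h : a < b) : Disjoint (mutIID a b).yes (mutIID a b).no := by
  rw [Set.disjoint_left]
  intro P hy hn
  have h1 : SD P.X P.Y ≤ a := hy
  have h2 : b ≤ mutDisj P.X P.Y := hn
  have h3 := Disj_le_SD P.X P.Y
  have h4 : mutDisj P.X P.Y ≤ Disj P.X P.Y := min_le_left _ _
  linarith

/-! ### Encodings over a finite alphabet -/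

/-- The alphabet in which instances are written. -/
inductive Letter : Type
  | tick
  | comma
  | tt
  | ff
  | var
  | not
  | and
  | or
  | out
  | fin
  deriving DecidableEq

instance : Fintype Letter where
  elems := {.tick, .comma, .tt, .ff, .var, .not, .and, .or, .out, .fin}
  complete x := by cases x <;> decide

/-- A natural number in unary, closed by a comma. -/
def encodeUnary (k : ℕ) : List Letter :=
  List.replicate k Letter.tick ++ [Letter.comma]

def encodeNode {n : ℕ} : Node n → List Letter
  | .var i => Letter.var :: encodeUnary i
  | .const true => [Letter.tt]
  | .const false => [Letter.ff]
  | .not p => Letter.not :: encodeUnary p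
  | .and p q => Letter.and :: (encodeUnary p ++ encodeUnary q)
  | .or p q => Letter.or :: (encodeUnary p ++ encodeUnary q)

/-- A circuit is written as the list of its nodes followed by the list of its output nodes. -/
def encodeCircuit {n m : ℕ} (C : Circuit n m) : List Letter :=
  C.nodes.flatMap encodeNode ++
    ((List.ofFn C.outputs).flatMap fun p => Letter.out :: encodeUnary p) ++ [Letter.fin]

/-- A pair of circuits is written as the number of inputs followed by the two circuits. -/
def encodePair (P : CircuitPair) : List Letter :=
  encodeUnary P.n ++ encodeCircuit P.X ++ encodeCircuit P.Y

/-- The encoding of `(X, Y, 1^k)`. -/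
def encodePairParam (I : CircuitPair × ℕ) : List Letter :=
  encodePair I.1 ++ encodeUnary I.2

theorem encodeUnary_append_inj {k l : ℕ} {s t : List Letter}
    (h : encodeUnary k ++ s = encodeUnary l ++ t) : k = l ∧ s = t := by
  induction k generalizing l with
  | zero =>
    cases l with
    | zero => simpa [encodeUnary] using h
    | succ l => simp [encodeUnary, List.replicate_succ] at h
  | succ k ih =>
    cases l with
    | zero => simp [encodeUnary, List.replicate_succ] at h
    | succ l =>
      have := @ih l (by simpa [encodeUnary, List.replicate_succ] using h)
      exact ⟨by omega, this.2⟩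

theorem encodeNode_append_inj {n : ℕ} {g g' : Node n} {s t : List Letter}
    (h : encodeNode g ++ s = encodeNode g' ++ t) : g = g' ∧ s = t := by
  have two : ∀ {p q p' q' : ℕ}, encodeUnary p ++ (encodeUnary q ++ s) =
      encodeUnary p' ++ (encodeUnary q' ++ t) → (p = p' ∧ q = q') ∧ s = t := by
    intro p q p' q' h
    obtain ⟨h1, h2⟩ := encodeUnary_append_inj h
    obtain ⟨h3, h4⟩ := encodeUnary_append_inj h2
    exact ⟨⟨h1, h3⟩, h4⟩
  rcases g with i | (_ | _) | p | ⟨p, q⟩ | ⟨p, q⟩ <;>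
    rcases g' with i' | (_ | _) | p' | ⟨p', q'⟩ | ⟨p', q'⟩ <;>
    simp only [encodeNode, List.cons_append, List.append_assoc, List.nil_append, List.cons.injEq,
      reduceCtorEq, false_and, true_and] at h
  · obtain ⟨h1, h2⟩ := encodeUnary_append_inj h
    exact ⟨by rw [Fin.ext h1], h2⟩
  · exact ⟨rfl, h⟩
  · exact ⟨rfl, h⟩
  · obtain ⟨h1, h2⟩ := encodeUnary_append_inj h
    exact ⟨by rw [h1], h2⟩
  · obtain ⟨⟨h1, h2⟩, h3⟩ := two h
    exact ⟨by rw [h1, h2], h3⟩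
  · obtain ⟨⟨h1, h2⟩, h3⟩ := two h
    exact ⟨by rw [h1, h2], h3⟩

theorem encodeOutputs_append_inj {L L' : List ℕ} {s t : List Letter}
    (h : (L.flatMap fun p => Letter.out :: encodeUnary p) ++ Letter.fin :: s =
      (L'.flatMap fun p => Letter.out :: encodeUnary p) ++ Letter.fin :: t) : L = L' ∧ s = t := by
  induction L generalizing L' with
  | nil => cases L' <;> simp_all
  | cons p L ih =>
    cases L' with
    | nil => simp at h
    | cons p' L' =>
      simp only [List.flatMap_cons, List.cons_append, List.append_assoc, List.cons.injEq,
        true_and] at h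
      obtain ⟨h1, h2⟩ := encodeUnary_append_inj h
      obtain ⟨h3, h4⟩ := ih h2
      exact ⟨by rw [h1, h3], h4⟩

theorem encodeBody_append_inj {n : ℕ} {N N' : List (Node n)} {L L' : List ℕ} {s t : List Letter}
    (h : N.flatMap encodeNode ++
        ((L.flatMap fun p => Letter.out :: encodeUnary p) ++ Letter.fin :: s) =
      N'.flatMap encodeNode ++
        ((L'.flatMap fun p => Letter.out :: encodeUnary p) ++ Letter.fin :: t)) :
    N = N' ∧ L = L' ∧ s = t := by
  have key : ∀ (g : Node n) (r : List Letter) (M : List ℕ) (u : List Letter),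
      encodeNode g ++ r ≠ (M.flatMap fun p => Letter.out :: encodeUnary p) ++ Letter.fin :: u := by
    intro g r M u h
    rcases g with i | (_ | _) | p | ⟨p, q⟩ | ⟨p, q⟩ <;> cases M <;> simp [encodeNode] at h
  induction N generalizing N' with
  | nil =>
    cases N' with
    | nil => exact ⟨rfl, encodeOutputs_append_inj (by simpa using h)⟩
    | cons g' N' =>
      simp only [List.flatMap_nil, List.nil_append, List.flatMap_cons, List.append_assoc] at h
      exact (key _ _ _ _ h.symm).elim
  | cons g N ih =>
    cases N' with
    | nil =>
      simp only [List.flatMap_nil, List.nil_append, List.flatMap_cons, List.append_assoc] at h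
      exact (key _ _ _ _ h).elim
    | cons g' N' =>
      simp only [List.flatMap_cons, List.append_assoc] at h
      obtain ⟨h1, h2⟩ := encodeNode_append_inj h
      obtain ⟨h3, h4⟩ := ih h2
      exact ⟨by rw [h1, h3], h4⟩

theorem encodeCircuit_append_inj {n m m' : ℕ} {C : Circuit n m} {C' : Circuit n m'}
    {s t : List Letter} (h : encodeCircuit C ++ s = encodeCircuit C' ++ t) :
    m = m' ∧ HEq C C' ∧ s = t := by
  obtain ⟨h1, h2, h3⟩ := encodeBody_append_inj (N := C.nodes) (N' := C'.nodes)
    (L := List.ofFn C.outputs) (L' := List.ofFn C'.outputs) (s := s) (t := t)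
    (by simpa [encodeCircuit] using h)
  have hm : m = m' := by simpa using congrArg List.length h2
  subst hm
  refine ⟨rfl, heq_of_eq ?_, h3⟩
  cases C
  cases C'
  obtain rfl := h1
  obtain rfl := List.ofFn_injective h2
  rfl

theorem encodePair_append_inj {P Q : CircuitPair} {s t : List Letter}
    (h : encodePair P ++ s = encodePair Q ++ t) : P = Q ∧ s = t := by
  rcases P with ⟨n, m, X, Y⟩
  rcases Q with ⟨n', m', X', Y'⟩
  simp only [encodePair, List.append_assoc] at h
  obtain ⟨rfl, h2⟩ := encodeUnary_append_inj h
  obtain ⟨rfl, h3, h4⟩ := encodeCircuit_append_inj h2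
  obtain ⟨-, h5, h6⟩ := encodeCircuit_append_inj h4
  exact ⟨by rw [eq_of_heq h3, eq_of_heq h5], h6⟩

/-- Distinct instances have distinct encodings. -/
theorem encodePair_injective : Function.Injective encodePair := fun P Q h =>
  (encodePair_append_inj (s := []) (t := []) (by rw [h])).1

theorem encodePairParam_injective : Function.Injective encodePairParam := by
  rintro ⟨P, k⟩ ⟨Q, l⟩ h
  obtain ⟨h1, h2⟩ := encodePair_append_inj h
  have h3 := (encodeUnary_append_inj (s := []) (t := []) (congrArg (· ++ []) h2)).1
  exact Prod.ext h1 h3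

/-! ### Polynomial-time reductions -/

/-- `f` is computed by a (multi-stack) Turing machine within a number of steps that is bounded by
a polynomial in the length of the encoded input. -/
def PolyTime {α β : Type} (ea : α → List Letter) (eb : β → List Letter) (f : α → β) : Prop :=
  Nonempty (Turing.TM2ComputableInPolyTime ea eb f)

/-- `f` maps Yes instances of `P` to Yes instances of `Q` and No instances to No instances. -/
def MapsInstances {α β : Type} (P : PromiseProblem α) (Q : PromiseProblem β) (f : α → β) : Prop :=
  (∀ x ∈ P.yes, f x ∈ Q.yes) ∧ (∀ x ∈ P.no, f x ∈ Q.no)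

/-- Polynomial-time (many-one) reducibility of promise problems about pairs of circuits. -/
def Reduces (P Q : PromiseProblem CircuitPair) : Prop :=
  ∃ f : CircuitPair → CircuitPair, PolyTime encodePair encodePair f ∧ MapsInstances P Q f

/-- Reducibility of `P` to the family `Q k`, uniformly in `k`: one polynomial-time function that
is given the instance together with `1^k`. -/
def ReducesUniformly (P : PromiseProblem CircuitPair) (Q : ℕ → PromiseProblem CircuitPair) :
    Prop :=
  ∃ f : CircuitPair × ℕ → CircuitPair, PolyTime encodePairParam encodePair f ∧
    ∀ k, MapsInstances P (Q k) fun I => f (I, k)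

/-!
Two constructions act on a pair of circuits. The XOR construction squares the statistical
difference and at worst squares the mutual disjointness. Two independent copies at worst double the
statistical difference, and they square the distance of the mutual disjointness from one. Constantly
many iterations of the former and then of the latter bring the two errors below `1 / 8`; from there
on, an XOR construction followed by a direct product squares both errors, in units of `1 / 4`, so
that about `log k` rounds suffice and the size of the circuits grows only quadratically in `k`.

Both constructions apply to a single circuit with a selector bit that chooses between the two
circuits of the pair, and they duplicate this circuit with shifted positions. On the strings
that encode circuits with unary positions, this is within the reach of a loop language over a fixed
finite set of stacks, whose programs compile to Turing machines with a linear overhead in time.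
-/

/-- Structured programs over stacks indexed by `K` with symbols from `Γ`: `pop k next` continues
with the program chosen by the popped symbol (`none` on an empty stack), and `forEach k c body` pops
symbols off `k` as long as they satisfy `c` and runs `body a` for each popped `a`. -/
inductive StackProgram (K Γ : Type) : Type
  | skip
  | push (k : K) (a : Γ)
  | pop (k : K) (next : Option Γ → StackProgram K Γ)
  | seq (p q : StackProgram K Γ)
  | forEach (k : K) (c : Γ → Bool) (body : Γ → StackProgram K Γ)

infixr:60 " ;; " => StackProgram.seq

namespace StackProgram

open Function Turing

section Semantics

variable {K Γ S : Type} [DecidableEq K]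

/-- The number of steps of a loop over `l` that starts in the state `s`, where `f s a` is the state
after the iteration for `a` and `t a s` is the time of that iteration. -/
def loopTime (f : S → Γ → S) (t : Γ → S → ℕ) : List Γ → S → ℕ
  | [], _ => 1
  | a :: l, s => 1 + t a s + loopTime f t l (f s a)

/-- The stacks after the execution of a program. The body of a loop is supposed not to use the stack
that drives the loop, see `WellFormed`. -/
def exec : StackProgram K Γ → (K → List Γ) → K → List Γ
  | skip, s => s
  | push k a, s => update s k (a :: s k)
  | pop k next, s => (next (s k).head?).exec (update s k (s k).tail)
  | p ;; q, s => q.exec (p.exec s)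
  | forEach k c body, s =>
    update (((s k).takeWhile c).foldl (fun s a => (body a).exec s) s) k ((s k).dropWhile c)

/-- The number of steps that the Turing machine for a program takes. -/
def time : StackProgram K Γ → (K → List Γ) → ℕ
  | skip, _ => 1
  | push _ _, _ => 1
  | pop k next, s => 1 + (next (s k).head?).time (update s k (s k).tail)
  | p ;; q, s => p.time s + q.time (p.exec s)
  | forEach k c body, s =>
    loopTime (fun s a => (body a).exec s) (fun a => (body a).time) ((s k).takeWhile c) s

/-- The program does not mention the stack `j`. -/
def Avoids (j : K) : StackProgram K Γ → Prop
  | skip => True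
  | push k _ => k ≠ j
  | pop k next => k ≠ j ∧ ∀ o, (next o).Avoids j
  | p ;; q => p.Avoids j ∧ q.Avoids j
  | forEach k _ body => k ≠ j ∧ ∀ a, (body a).Avoids j

/-- No loop body mentions the stack that drives the loop. -/
def WellFormed : StackProgram K Γ → Prop
  | skip => True
  | push _ _ => True
  | pop _ next => ∀ o, (next o).WellFormed
  | p ;; q => p.WellFormed ∧ q.WellFormed
  | forEach k _ body => ∀ a, (body a).Avoids k ∧ (body a).WellFormed

attribute [simp] exec time Avoids WellFormed loopTime

theorem Avoids.exec_update {j : K} {p : StackProgram K Γ} (hp : p.Avoids j) (s : K → List Γ)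
    (l : List Γ) : p.exec (update s j l) = update (p.exec s) j l := by
  induction p generalizing s with
  | skip => rfl
  | push k a => simp [update_of_ne hp, update_comm hp]
  | pop k next ih =>
    simp only [exec, update_of_ne hp.1, ← ih _ (hp.2 _), update_comm hp.1]
  | seq p q ihp ihq => simp only [exec, ihp hp.1, ihq hp.2]
  | forEach k c body ih =>
    have foldl_update : ∀ (L : List Γ) (s : K → List Γ),
        L.foldl (fun s a => (body a).exec s) (update s j l) =
          update (L.foldl (fun s a => (body a).exec s) s) j l := by
      intro L
      induction L with
      | nil => exact fun _ => rfl
      | cons a L ihL => intro s; simp only [List.foldl_cons, ih a (hp.2 a), ihL]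
    simp only [exec, update_of_ne hp.1, foldl_update, update_comm hp.1]

theorem Avoids.time_update {j : K} {p : StackProgram K Γ} (hp : p.Avoids j) (s : K → List Γ)
    (l : List Γ) : p.time (update s j l) = p.time s := by
  induction p generalizing s with
  | skip => rfl
  | push k a => rfl
  | pop k next ih => simp only [time, update_of_ne hp.1, update_comm hp.1.symm, ih _ (hp.2 _)]
  | seq p q ihp ihq => simp only [time, hp.1.exec_update, ihp hp.1, ihq hp.2]
  | forEach k c body ih =>
    have loopTime_update : ∀ (L : List Γ) (s : K → List Γ),
        loopTime (fun s a => (body a).exec s) (fun a => (body a).time) L (update s j l) =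
          loopTime (fun s a => (body a).exec s) (fun a => (body a).time) L s := by
      intro L
      induction L with
      | nil => exact fun _ => rfl
      | cons a L ihL => intro s; simp only [loopTime, ih a (hp.2 a), (hp.2 a).exec_update, ihL]
    simp only [time, update_of_ne hp.1, loopTime_update]

end Semantics

section Compilation

variable {K Γ Λ : Type}

/-- The labels of the Turing machine for a program. -/
def Label : StackProgram K Γ → Type
  | skip => Unit
  | push _ _ => Unit
  | pop _ next => Option (Σ o, (next o).Label)
  | p ;; q => p.Label ⊕ q.Label
  | forEach _ _ body => Option (Σ a, (body a).Label)

/-- The label at which the execution of a program starts. -/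
def entry : (p : StackProgram K Γ) → p.Label
  | skip => ()
  | push _ _ => ()
  | pop _ _ => none
  | p ;; _ => .inl p.entry
  | forEach _ _ _ => none

/-- The statements of a program that is a part of a machine with labels `Λ`, where it has the labels
`ι l` and is left for the label `exit`. The internal state is the symbol read last. -/
def code : (p : StackProgram K Γ) → (p.Label → Λ) → Λ → p.Label →
    TM2.Stmt (fun _ : K => Γ) Λ (Option Γ)
  | skip, _, exit, _ => .goto fun _ => exit
  | push k a, _, exit, _ => .push k (fun _ => a) (.goto fun _ => exit)
  | pop k next, ι, exit, l =>
    match l with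
    | none => .pop k (fun _ o => o) (.goto fun o => ι (some ⟨o, (next o).entry⟩))
    | some ⟨o, l⟩ => (next o).code (fun l => ι (some ⟨o, l⟩)) exit l
  | p ;; q, ι, exit, l =>
    match l with
    | .inl l => p.code (fun l => ι (.inl l)) (ι (.inr q.entry)) l
    | .inr l => q.code (fun l => ι (.inr l)) exit l
  | forEach k c body, ι, exit, l =>
    match l with
    | none =>
      .peek k (fun _ o => o) <| .branch (fun o => o.any c)
        (.pop k (fun _ o => o) <| .goto fun o =>
          o.elim exit fun a => ι (some ⟨a, (body a).entry⟩))
        (.goto fun _ => exit)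
    | some ⟨a, l⟩ => (body a).code (fun l => ι (some ⟨a, l⟩)) (ι none) l

noncomputable instance [Fintype Γ] : (p : StackProgram K Γ) → Fintype p.Label
  | skip => inferInstanceAs (Fintype Unit)
  | push _ _ => inferInstanceAs (Fintype Unit)
  | pop _ next =>
    have (o : Option Γ) : Fintype (next o).Label := instFintypeLabel (next o)
    inferInstanceAs (Fintype (Option (Σ o, (next o).Label)))
  | p ;; q =>
    have := instFintypeLabel p
    have := instFintypeLabel q
    inferInstanceAs (Fintype (p.Label ⊕ q.Label))
  | forEach _ _ body =>
    have (a : Γ) : Fintype (body a).Label := instFintypeLabel (body a)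
    inferInstanceAs (Fintype (Option (Σ a, (body a).Label)))

variable [DecidableEq K]

/-- The machine `M` takes the configuration `c` to `c'` in exactly `t` steps. -/
def ReachesIn (M : Λ → TM2.Stmt (fun _ : K => Γ) Λ (Option Γ)) (t : ℕ)
    (c c' : TM2.Cfg (fun _ : K => Γ) Λ (Option Γ)) : Prop :=
  (flip bind (TM2.step M))^[t] (some c) = some c'

variable {M : Λ → TM2.Stmt (fun _ : K => Γ) Λ (Option Γ)}

theorem ReachesIn.trans {t t' : ℕ} {c c' c'' : TM2.Cfg (fun _ : K => Γ) Λ (Option Γ)}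
    (h : ReachesIn M t c c') (h' : ReachesIn M t' c' c'') : ReachesIn M (t + t') c c'' := by
  unfold ReachesIn at *
  rw [add_comm, iterate_add_apply, h, h']

theorem reachesIn_one (l : Λ) (v : Option Γ) (s : K → List Γ) :
    ReachesIn M 1 ⟨some l, v, s⟩ (TM2.stepAux (M l) v s) := rfl

/-- Where the code of a program is entered with the stacks `s`, it is left with the stacks
`p.exec s` after `p.time s` steps. -/
def IsCorrectFor (p : StackProgram K Γ) (M : Λ → TM2.Stmt (fun _ : K => Γ) Λ (Option Γ)) : Prop :=
  ∀ (ι : p.Label → Λ) (exit : Λ), (∀ l, M (ι l) = p.code ι exit l) → ∀ v s, ∃ v',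
    ReachesIn M (p.time s) ⟨some (ι p.entry), v, s⟩ ⟨some exit, v', p.exec s⟩

theorem isCorrectFor_forEach (k : K) (c : Γ → Bool) {body : Γ → StackProgram K Γ}
    (avoids : ∀ a, (body a).Avoids k) (correct : ∀ a, (body a).IsCorrectFor M) :
    (forEach k c body).IsCorrectFor M := by
  intro ι exit hM v s
  have code_entry : M (ι none) = _ := hM none
  have run_loop : ∀ (l : List Γ) (v : Option Γ) (s : K → List Γ), ∃ v',
      ReachesIn M (loopTime (fun s a => (body a).exec s) (fun a => (body a).time) (l.takeWhile c) s)
        ⟨some (ι none), v, update s k l⟩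
        ⟨some exit, v', update ((l.takeWhile c).foldl (fun s a => (body a).exec s) s) k
          (l.dropWhile c)⟩ := by
    intro l
    induction l with
    | nil =>
      intro v s
      refine ⟨none, ?_⟩
      have := reachesIn_one (M := M) (ι none) v (update s k [])
      rw [code_entry] at this
      simpa [code] using this
    | cons a l ih =>
      intro v s
      have test := reachesIn_one (M := M) (ι none) v (update s k (a :: l))
      rw [code_entry] at test
      by_cases hc : c a
      · obtain ⟨v₁, run_body⟩ := correct a (fun l => ι (some ⟨a, l⟩)) (ι none)
          (fun l => hM (some ⟨a, l⟩)) (some a) (update s k l)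
        obtain ⟨v₂, run_rest⟩ := ih v₁ ((body a).exec s)
        rw [(avoids a).time_update, (avoids a).exec_update] at run_body
        refine ⟨v₂, ?_⟩
        simp only [code, TM2.stepAux, update_self, update_idem, List.head?_cons, List.tail_cons,
          Option.any_some, hc, cond_true, Option.elim_some] at test
        simpa [List.takeWhile_cons_of_pos hc, List.dropWhile_cons_of_pos hc] using
          (test.trans run_body).trans run_rest
      · refine ⟨some a, ?_⟩
        simpa [code, hc] using test
  have run := run_loop (s k) v s
  rwa [update_eq_self] at run

theorem WellFormed.isCorrectFor {p : StackProgram K Γ} (hp : p.WellFormed) :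
    p.IsCorrectFor M := by
  induction p with
  | skip =>
    intro ι exit hM v s
    have := reachesIn_one (M := M) (ι ()) v s
    rw [show M (ι ()) = _ from hM ()] at this
    exact ⟨v, this⟩
  | push k a =>
    intro ι exit hM v s
    have := reachesIn_one (M := M) (ι ()) v s
    rw [show M (ι ()) = _ from hM ()] at this
    exact ⟨v, this⟩
  | pop k next ih =>
    intro ι exit hM v s
    have read := reachesIn_one (M := M) (ι none) v s
    rw [show M (ι none) = _ from hM none] at read
    obtain ⟨v', run_next⟩ := ih (s k).head? (hp _) (fun l => ι (some ⟨_, l⟩)) exit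
      (fun l => hM (some ⟨_, l⟩)) (s k).head? (update s k (s k).tail)
    exact ⟨v', read.trans run_next⟩
  | seq p q ihp ihq =>
    intro ι exit hM v s
    obtain ⟨v₁, run_p⟩ := ihp hp.1 (fun l => ι (.inl l)) (ι (.inr q.entry))
      (fun l => hM (.inl l)) v s
    obtain ⟨v₂, run_q⟩ := ihq hp.2 (fun l => ι (.inr l)) exit (fun l => hM (.inr l)) v₁ (p.exec s)
    exact ⟨v₂, run_p.trans run_q⟩
  | forEach k c body ih =>
    exact isCorrectFor_forEach k c (fun a => (hp a).1) fun a => ih a (hp a).2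

/-- The statements of the machine that runs a program and halts with the initial internal state. -/
def machineCode (p : StackProgram K Γ) :
    Option p.Label → TM2.Stmt (fun _ : K => Γ) (Option p.Label) (Option Γ)
  | none => .load (fun _ => none) .halt
  | some l => p.code some none l

/-- The Turing machine that runs a program. -/
noncomputable def machine [Fintype K] [Fintype Γ] (p : StackProgram K Γ) (input output : K) :
    FinTM2 where
  K := K
  k₀ := input
  k₁ := output
  Γ := fun _ => Γ
  Λ := Option p.Label
  main := some p.entry
  σ := Option Γ
  initialState := none
  m := p.machineCode

/-- The stacks with content `l` on the stack `k` and nothing else. -/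
def single (k : K) (l : List Γ) : K → List Γ := update (fun _ => []) k l

@[simp]
theorem single_self (k : K) (l : List Γ) : single k l k = l := update_self ..

@[simp]
theorem single_of_ne {j k : K} (h : j ≠ k) (l : List Γ) : single k l j = [] := update_of_ne h ..

theorem WellFormed.reachesIn_machineCode {p : StackProgram K Γ} (hp : p.WellFormed)
    (s : K → List Γ) : ReachesIn p.machineCode (p.time s + 1) ⟨some (some p.entry), none, s⟩
      ⟨none, none, p.exec s⟩ := by
  obtain ⟨v, run⟩ := hp.isCorrectFor (M := p.machineCode) some none (fun _ => rfl) none s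
  exact run.trans (reachesIn_one none v _)

end Compilation

theorem polyTime_of_exec {K α β : Type} [DecidableEq K] [Finite K] {p : StackProgram K Letter}
    (hp : p.WellFormed) {input output : K} {ea : α → List Letter} {eb : β → List Letter}
    {f : α → β} (exec_eq : ∀ a, p.exec (single input (ea a)) = single output (eb (f a)))
    {T : Polynomial ℕ} (time_le : ∀ a, p.time (single input (ea a)) ≤ T.eval (ea a).length) :
    PolyTime ea eb f := by
  have := Fintype.ofFinite K
  have initList_eq (l : List Letter) : initList (p.machine input output) (l.map id) =
      ⟨some (some p.entry), none, single input l⟩ := by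
    refine congrArg (TM2.Cfg.mk _ _) (funext fun (k : K) => ?_)
    by_cases h : k = input
    · subst h
      exact (dif_pos rfl).trans ((List.map_id l).trans (single_self k l).symm)
    · exact (dif_neg h).trans (single_of_ne h l).symm
  have haltList_eq (l : List Letter) : haltList (p.machine input output) (l.map id) =
      ⟨none, none, single output l⟩ := by
    refine congrArg (TM2.Cfg.mk _ _) (funext fun (k : K) => ?_)
    by_cases h : k = output
    · subst h
      exact (dif_pos rfl).trans ((List.map_id l).trans (single_self k l).symm)
    · exact (dif_neg h).trans (single_of_ne h l).symm
  exact ⟨{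
    tm := p.machine input output
    inputAlphabet := Equiv.refl _
    outputAlphabet := Equiv.refl _
    time := T + 1
    outputsFun := fun a =>
      { steps := p.time (single input (ea a)) + 1
        evals_in_steps := by
          have run := hp.reachesIn_machineCode (single input (ea a))
          rw [exec_eq] at run
          exact (congrArg (fun c => (flip bind _)^[_] (some c)) (initList_eq _)).trans
            (Eq.trans run (congrArg some (haltList_eq _).symm))
        steps_le_m := by simpa using time_le a } }⟩

end StackProgram

namespace StackProgram

open Function

section Elementary

variable {K Γ S : Type} [DecidableEq K]

theorem loopTime_of_const {f : S → Γ → S} {t : Γ → S → ℕ} {c : ℕ} (ht : ∀ a s, t a s = c)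
    (l : List Γ) (s : S) : loopTime f t l s = 1 + l.length * (1 + c) := by
  induction l generalizing s with
  | nil => simp
  | cons a l ih => simp only [loopTime, ht, ih, List.length_cons]; ring

theorem loopTime_le {f : S → Γ → S} {t : Γ → S → ℕ} {c : ℕ} (I : ℕ → S → Prop)
    (hf : ∀ a s r, I (r + 1) s → I r (f s a)) (ht : ∀ a s r, I (r + 1) s → t a s ≤ c) (l : List Γ)
    {s : S} (hs : I l.length s) : loopTime f t l s ≤ 1 + l.length * (1 + c) := by
  induction l generalizing s with
  | nil => simp
  | cons a l ih =>
    have := ht a s _ hs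
    have := ih (hf a s _ hs)
    simp only [loopTime, List.length_cons, Nat.add_mul]
    omega

/-- Pushes the symbols of a list one after the other. -/
def pushAll (k : K) : List Γ → StackProgram K Γ
  | [] => skip
  | a :: l => push k a ;; pushAll k l

/-- Empties the stack `k` and runs `body a` for each symbol `a` on it. -/
def forAll (k : K) (body : Γ → StackProgram K Γ) : StackProgram K Γ :=
  forEach k (fun _ => true) body

/-- Empties the stack `k`. -/
def clear (k : K) : StackProgram K Γ := forAll k fun _ => skip

/-- Moves the symbols that satisfy `c` from `i` to `j`, up to the first one that does not. Their
order is reversed. -/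
def moveWhile (c : Γ → Bool) (i j : K) : StackProgram K Γ := forEach i c (push j)

/-- Moves everything from `i` to `j`, in reverse order. -/
def moveAll (i j : K) : StackProgram K Γ := forAll i (push j)

/-- Puts the contents of `i` on top of `j`, in the same order. -/
def copy (scratch i j : K) : StackProgram K Γ :=
  moveAll i scratch ;; forAll scratch fun a => push i a ;; push j a

/-- Makes the contents of `j` equal to that of `i`. -/
def load (scratch i j : K) : StackProgram K Γ := clear j ;; copy scratch i j

/-- The sequence of `n` copies of a program, for a number `n` fixed in advance. -/
def iterate (p : StackProgram K Γ) : ℕ → StackProgram K Γ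
  | 0 => skip
  | n + 1 => p ;; iterate p n

section Exec

variable (s : K → List Γ) {scratch i j k : K}

@[simp]
theorem exec_pushAll (l : List Γ) : (pushAll k l).exec s = update s k (l.reverse ++ s k) := by
  induction l generalizing s with
  | nil => simp [pushAll]
  | cons a l ih => simp [pushAll, ih]

@[simp]
theorem exec_forAll (body : Γ → StackProgram K Γ) : (forAll k body).exec s =
    update ((s k).foldl (fun s a => (body a).exec s) s) k [] := by
  simp [forAll, List.takeWhile_eq_self_iff.2, List.dropWhile_eq_nil_iff.2]

@[simp]
theorem exec_clear : (clear k).exec s = update s k [] := by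
  have foldl_fst (l : List Γ) : l.foldl (fun s _ => s) s = s := by simp
  simp [clear, foldl_fst]

theorem foldl_update_cons (l : List Γ) :
    l.foldl (fun s a => update s j (a :: s j)) s = update s j (l.reverse ++ s j) := by
  induction l generalizing s with
  | nil => simp
  | cons a l ih => simp [ih]

@[simp]
theorem exec_moveWhile (c : Γ → Bool) : (moveWhile c i j).exec s =
    update (update s j (((s i).takeWhile c).reverse ++ s j)) i ((s i).dropWhile c) := by
  simp [moveWhile, foldl_update_cons]

@[simp]
theorem exec_moveAll : (moveAll i j).exec s = update (update s j ((s i).reverse ++ s j)) i [] := by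
  simp [moveAll, foldl_update_cons]

@[simp]
theorem exec_copy (hs : s scratch = []) (hi : i ≠ scratch) (hj : j ≠ scratch) (hij : i ≠ j) :
    (copy scratch i j).exec s = update s j (s i ++ s j) := by
  have foldl_push (l : List Γ) (s : K → List Γ) :
      l.foldl (fun s a => update (update s i (a :: s i)) j (a :: s j)) s =
        update (update s i (l.reverse ++ s i)) j (l.reverse ++ s j) := by
    induction l generalizing s with
    | nil => simp
    | cons a l ih =>
      rw [List.foldl_cons, ih, update_comm hij, update_idem]
      simp [hij, update_comm hij]
  have exec_eq : (copy scratch i j).exec s =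
      update (update (update (update s scratch (s i).reverse) i (s i)) j (s i ++ s j))
        scratch [] := by
    simp [copy, foldl_push, hs, hi.symm, hij.symm, hj]
  funext x
  by_cases hxj : x = j <;> by_cases hxi : x = i <;> by_cases hxs : x = scratch <;>
    simp_all

@[simp]
theorem exec_load (hs : s scratch = []) (hi : i ≠ scratch) (hj : j ≠ scratch) (hij : i ≠ j) :
    (load scratch i j).exec s = update s j (s i) := by
  simp [load, hs, hi, hj, hij, hj.symm]

end Exec

section Time

variable (s : K → List Γ) {scratch i j k : K}

@[simp]
theorem time_pushAll (l : List Γ) : (pushAll k l).time s = l.length + 1 := by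
  induction l generalizing s with
  | nil => rfl
  | cons a l ih => simp [pushAll, ih, add_comm]

@[simp]
theorem time_forAll (body : Γ → StackProgram K Γ) : (forAll k body).time s =
    loopTime (fun s a => (body a).exec s) (fun a => (body a).time) (s k) s := by
  simp [forAll, List.takeWhile_eq_self_iff.2]

@[simp]
theorem time_clear : (clear k).time s = 1 + (s k).length * 2 := by
  simp [clear, loopTime_of_const (c := 1)]

@[simp]
theorem time_moveWhile (c : Γ → Bool) :
    (moveWhile c i j).time s = 1 + ((s i).takeWhile c).length * 2 := by
  simp [moveWhile, loopTime_of_const (c := 1)]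

@[simp]
theorem time_moveAll : (moveAll i j).time s = 1 + (s i).length * 2 := by
  simp [moveAll, loopTime_of_const (c := 1)]

@[simp]
theorem time_copy (hs : s scratch = []) (hi : i ≠ scratch) :
    (copy scratch i j).time s = 2 + (s i).length * 5 := by
  simp [copy, loopTime_of_const (c := 2), hs, hi.symm]
  omega

@[simp]
theorem time_load (hs : s scratch = []) (hi : i ≠ scratch) (hj : j ≠ scratch) (hij : i ≠ j) :
    (load scratch i j).time s = 3 + (s i).length * 5 + (s j).length * 2 := by
  simp [load, hs, hi, hij, hj.symm]
  omega

end Time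

end Elementary

section WellFormed

variable {K Γ : Type} {scratch i j k x : K}

@[simp]
theorem avoids_pushAll (h : k ≠ x) (l : List Γ) : (pushAll k l).Avoids x := by
  induction l with
  | nil => trivial
  | cons a l ih => exact ⟨h, ih⟩

@[simp]
theorem avoids_forAll {body : Γ → StackProgram K Γ} :
    (forAll k body).Avoids x ↔ k ≠ x ∧ ∀ a, (body a).Avoids x := Iff.rfl

@[simp]
theorem avoids_clear : (clear k : StackProgram K Γ).Avoids x ↔ k ≠ x := by simp [clear]

@[simp]
theorem avoids_moveWhile (hi : i ≠ x) (hj : j ≠ x) (c : Γ → Bool) : (moveWhile c i j).Avoids x := by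
  simp [moveWhile, hi, hj]

@[simp]
theorem avoids_moveAll (hi : i ≠ x) (hj : j ≠ x) : (moveAll i j : StackProgram K Γ).Avoids x :=
  ⟨hi, fun _ => hj⟩

@[simp]
theorem avoids_copy (hs : scratch ≠ x) (hi : i ≠ x) (hj : j ≠ x) :
    (copy scratch i j : StackProgram K Γ).Avoids x := by simp [copy, hs, hi, hj]

@[simp]
theorem avoids_load (hs : scratch ≠ x) (hi : i ≠ x) (hj : j ≠ x) :
    (load scratch i j : StackProgram K Γ).Avoids x := by simp [load, hs, hi, hj]

@[simp]
theorem wellFormed_pushAll (l : List Γ) : (pushAll k l).WellFormed := by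
  induction l with
  | nil => trivial
  | cons a l ih => exact ⟨trivial, ih⟩

@[simp]
theorem wellFormed_forAll {body : Γ → StackProgram K Γ} : (forAll k body).WellFormed ↔
    ∀ a, (body a).Avoids k ∧ (body a).WellFormed := Iff.rfl

@[simp]
theorem wellFormed_clear : (clear k : StackProgram K Γ).WellFormed := by simp [clear]

@[simp]
theorem wellFormed_moveWhile (hij : i ≠ j) (c : Γ → Bool) : (moveWhile c i j).WellFormed := by
  simp [moveWhile, hij.symm]

@[simp]
theorem wellFormed_moveAll (hij : i ≠ j) : (moveAll i j : StackProgram K Γ).WellFormed :=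
  fun _ => ⟨hij.symm, trivial⟩

@[simp]
theorem wellFormed_copy (hi : i ≠ scratch) (hj : j ≠ scratch) :
    (copy scratch i j : StackProgram K Γ).WellFormed := by simp [copy, hi, hj]

@[simp]
theorem wellFormed_load (hi : i ≠ scratch) (hj : j ≠ scratch) :
    (load scratch i j : StackProgram K Γ).WellFormed := by simp [load, hi, hj]

theorem WellFormed.iterate {p : StackProgram K Γ} (hp : p.WellFormed) (n : ℕ) :
    (p.iterate n).WellFormed := by
  induction n with
  | zero => trivial
  | succ _ ih => exact ⟨hp, ih⟩

end WellFormed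

/-- A program that writes `l` on the stack `true`, whatever is on the stack `false`. -/
def constant (l : List Letter) : StackProgram Bool Letter := clear false ;; pushAll true l.reverse

theorem polyTime_const {α β : Type} (ea : α → List Letter) (eb : β → List Letter) (b : β) :
    PolyTime ea eb fun _ => b := by
  refine polyTime_of_exec (p := constant (eb b)) (input := false) (output := true)
    ⟨wellFormed_clear, wellFormed_pushAll _⟩ (T := .C 2 * .X + .C ((eb b).length + 2)) ?_ ?_
  · intro a
    funext k
    cases k <;> simp [constant, single_of_ne]
  · intro a
    simp [constant]
    omega

end StackProgram

section Nodes

variable {n n' : ℕ}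

/-- The node with input indices raised by `v` and node positions raised by `d`. -/
def Node.shift (v d : ℕ) (hv : n + v ≤ n') : Node n → Node n'
  | .var i => .var ⟨i + v, by omega⟩
  | .const c => .const c
  | .not p => .not (p + d)
  | .and p q => .and (p + d) (q + d)
  | .or p q => .or (p + d) (q + d)

/-- Each node of the list, whose first node has position `k`, reads only earlier nodes. -/
def PredsLt : ℕ → List (Node n) → Prop
  | _, [] => True
  | k, g :: L => (∀ p ∈ g.preds, p < k) ∧ PredsLt (k + 1) L

theorem predsLt_append {k : ℕ} {L L' : List (Node n)} :
    PredsLt k (L ++ L') ↔ PredsLt k L ∧ PredsLt (k + L.length) L' := by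
  induction L generalizing k with
  | nil => simp [PredsLt]
  | cons g L ih => simp [PredsLt, ih, and_assoc, add_comm, add_left_comm]

theorem predsLt_iff_getElem {k : ℕ} {L : List (Node n)} :
    PredsLt k L ↔ ∀ (j : ℕ) (hj : j < L.length), ∀ p ∈ (L[j]).preds, p < k + j := by
  induction L generalizing k with
  | nil => simp [PredsLt]
  | cons g L ih =>
    simp only [PredsLt, ih, List.length_cons]
    constructor
    · rintro ⟨h_head, h_tail⟩ (_ | j) hj p hp
      · exact h_head p hp
      · have := h_tail j (by omega) p hp
        omega
    · intro h
      refine ⟨fun p hp => h 0 (by omega) p hp, fun j hj p hp => ?_⟩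
      have := h (j + 1) (by omega) p hp
      omega

theorem PredsLt.shift {k v d : ℕ} (hv : n + v ≤ n') {L : List (Node n)} (h : PredsLt k L) :
    PredsLt (k + d) (L.map (Node.shift v d hv)) := by
  induction L generalizing k with
  | nil => trivial
  | cons g L ih =>
    refine ⟨?_, by simpa [Nat.add_right_comm] using ih h.2⟩
    have h_head := h.1
    cases g <;> simp_all [Node.shift, Node.preds]

theorem Circuit.predsLt {m : ℕ} (C : Circuit n m) : PredsLt 0 C.nodes :=
  predsLt_iff_getElem.2 (by simpa using C.preds_lt)

/-- The values of all nodes on input `x`, where `v` lists the values of the nodes before `L`. -/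
def valuesFrom (x : Fin n → Bool) (v : List Bool) (L : List (Node n)) : List Bool :=
  L.foldl (fun v g => v ++ [g.eval x v]) v

section ValuesFrom

variable (x : Fin n → Bool)

@[simp]
theorem valuesFrom_cons (v : List Bool) (g : Node n) (L : List (Node n)) :
    valuesFrom x v (g :: L) = valuesFrom x (v ++ [g.eval x v]) L := rfl

theorem valuesFrom_append (v : List Bool) (L L' : List (Node n)) :
    valuesFrom x v (L ++ L') = valuesFrom x (valuesFrom x v L) L' := List.foldl_append

@[simp]
theorem length_valuesFrom (v : List Bool) (L : List (Node n)) :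
    (valuesFrom x v L).length = v.length + L.length := by
  induction L generalizing v with
  | nil => rfl
  | cons g L ih => simp [ih, add_comm, add_left_comm]

theorem getD_valuesFrom {v : List Bool} {p : ℕ} (hp : p < v.length) (L : List (Node n)) :
    (valuesFrom x v L).getD p false = v.getD p false := by
  induction L generalizing v with
  | nil => rfl
  | cons g L ih =>
    rw [valuesFrom_cons, ih (by simp; omega), List.getD_append _ _ _ _ hp]

theorem getD_append_add (u v : List Bool) {d : ℕ} (hd : u.length = d) (p : ℕ) :
    (u ++ v).getD (p + d) false = v.getD p false := by
  rw [← hd, List.getD_append_right _ _ _ _ (by omega), Nat.add_sub_cancel]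

theorem valuesFrom_shift {k d : ℕ} (hk : n + k ≤ n') {x' : Fin n' → Bool}
    (hx : ∀ i : Fin n, x' ⟨i + k, by omega⟩ = x i) {u : List Bool} (hu : u.length = d)
    (v : List Bool) (L : List (Node n)) :
    valuesFrom x' (u ++ v) (L.map (Node.shift k d hk)) = u ++ valuesFrom x v L := by
  induction L generalizing v with
  | nil => rfl
  | cons g L ih =>
    have eval_shift : (g.shift k d hk).eval x' (u ++ v) = g.eval x v := by
      cases g <;> simp only [Node.shift, Node.eval, getD_append_add u v hu, hx]
    rw [List.map_cons, valuesFrom_cons, eval_shift, List.append_assoc, ih, valuesFrom_cons]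

end ValuesFrom

theorem Circuit.values_eq {m : ℕ} (C : Circuit n m) (x : Fin n → Bool) :
    C.values x = valuesFrom x [] C.nodes := rfl

theorem length_encodeNode_le {b : ℕ} (g : Node n) (h : ∀ p ∈ g.preds, p < b) :
    (encodeNode g).length ≤ n + 2 * b + 3 := by
  rcases g with i | (_ | _) | p | ⟨p, q⟩ | ⟨p, q⟩ <;>
    simp [encodeNode, encodeUnary, Node.preds] at h ⊢ <;> omega

theorem length_flatMap_encodeNode_le {k b : ℕ} {L : List (Node n)} (h : PredsLt k L)
    (hb : k + L.length ≤ b) : (L.flatMap encodeNode).length ≤ L.length * (n + 2 * b + 3) := by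
  induction L generalizing k with
  | nil => simp
  | cons g L ih =>
    simp only [List.length_cons] at hb
    have h_head := length_encodeNode_le (b := b) g fun p hp => (h.1 p hp).trans_le (by omega)
    have h_tail := ih h.2 (by omega)
    simp only [List.flatMap_cons, List.length_append, List.length_cons, Nat.add_mul]
    omega

theorem length_le_length_flatMap_encodeNode (L : List (Node n)) :
    L.length ≤ (L.flatMap encodeNode).length := by
  induction L with
  | nil => simp
  | cons g L ih =>
    have : 1 ≤ (encodeNode g).length := by
      rcases g with i | (_ | _) | p | ⟨p, q⟩ | ⟨p, q⟩ <;> simp [encodeNode]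
    simp only [List.flatMap_cons, List.length_append, List.length_cons]
    omega

end Nodes

/-- The encoding of a list of output positions, as it occurs in `encodeCircuit`. -/
def encodeOutputs (L : List ℕ) : List Letter := L.flatMap fun p => Letter.out :: encodeUnary p

theorem length_encodeOutputs_le {b : ℕ} {L : List ℕ} (h : ∀ p ∈ L, p < b) :
    (encodeOutputs L).length ≤ L.length * (b + 1) := by
  simp only [encodeOutputs, List.length_flatMap, encodeUnary, List.length_cons, List.length_append,
    List.length_replicate, List.length_nil]
  refine (List.sum_le_card_nsmul _ (b + 1) ?_).trans (by simp)
  simp only [List.mem_map, forall_exists_index, and_imp, forall_apply_eq_imp_iff₂]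
  intro p hp
  have := h p hp
  omega

theorem two_mul_length_le_length_encodeOutputs (L : List ℕ) :
    2 * L.length ≤ (encodeOutputs L).length := by
  induction L with
  | nil => simp
  | cons p L ih =>
    simp only [encodeOutputs, List.flatMap_cons, List.length_append, List.length_cons,
      encodeUnary] at ih ⊢
    omega

theorem encodeCircuit_eq {n m : ℕ} (C : Circuit n m) : encodeCircuit C =
    C.nodes.flatMap encodeNode ++ encodeOutputs (List.ofFn C.outputs) ++ [Letter.fin] := rfl

/-- A circuit whose node at position `0` is left open for a selector bit: `body` lists the nodes at
the positions from `1` on. It represents the pair of circuits for the two values of the selector. -/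
structure SelectorCircuit where
  n : ℕ
  m : ℕ
  body : List (Node n)
  outs : Fin m → ℕ
  predsLt : PredsLt 1 body
  outs_lt : ∀ o, outs o < body.length + 1

namespace SelectorCircuit

/-- The circuit obtained by fixing the selector. -/
def circuit (W : SelectorCircuit) (c : Bool) : Circuit W.n W.m where
  nodes := Node.const c :: W.body
  outputs := W.outs
  preds_lt := by
    have h : PredsLt 0 (Node.const c :: W.body) := ⟨by simp [Node.preds], W.predsLt⟩
    simpa using predsLt_iff_getElem.1 h
  outputs_lt := by simpa using W.outs_lt

theorem values_circuit (W : SelectorCircuit) (c : Bool) (x : Fin W.n → Bool) :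
    (W.circuit c).values x = valuesFrom x [c] W.body := rfl

theorem eval_circuit_apply (W : SelectorCircuit) (c : Bool) (x : Fin W.n → Bool) (o : Fin W.m) :
    (W.circuit c).eval x o = ((W.circuit c).values x).getD (W.outs o) false := rfl

/-- The pair of circuits that a circuit with a selector represents. -/
def pair (W : SelectorCircuit) : CircuitPair := ⟨W.n, W.m, W.circuit false, W.circuit true⟩

/-- With a selector bit `c` at position `0`, these nodes put a fresh random bit `t`, the input
variable `0`, at position `1` and `xor c t` at position `5`. -/
def xorHeader (n : ℕ) : List (Node (n + n + 1)) :=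
  [.var 0, .and 0 1, .not 2, .or 0 1, .and 3 4]

theorem predsLt_xorHeader (n : ℕ) : PredsLt 1 (xorHeader n) := by
  simp [xorHeader, PredsLt, Node.preds]

/-- The position from which `double` takes the selector of the first copy. -/
def firstSelector (split : Bool) : ℕ := bif split then 1 else 0

/-- The position from which `double` takes the selector of the second copy. -/
def secondSelector (split : Bool) : ℕ := bif split then 5 else 0

/-- Two copies with independent inputs. Without `split`, both copies have the given selector, which
takes the direct product of the two circuits with themselves. With `split`, the selectors of the
copies are random bits whose exclusive or is the given selector, which is the XOR construction. -/
def double (split : Bool) (W : SelectorCircuit) : SelectorCircuit where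
  n := W.n + W.n + 1
  m := W.m + W.m
  body := xorHeader W.n ++
    (.or (firstSelector split) (firstSelector split) ::
      W.body.map (Node.shift 1 6 (by omega))) ++
    (.or (secondSelector split) (secondSelector split) ::
      W.body.map (Node.shift (W.n + 1) (W.body.length + 7) (by omega)))
  outs := Fin.append (fun o => W.outs o + 6) (fun o => W.outs o + (W.body.length + 7))
  predsLt := by
    simp only [predsLt_append]
    refine ⟨⟨predsLt_xorHeader _, ?_, ?_⟩, ?_, ?_⟩
    · cases split <;> simp [firstSelector, xorHeader, Node.preds]
    · simpa [xorHeader, add_comm] using W.predsLt.shift (d := 6) (v := 1) (n' := W.n + W.n + 1) _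
    · cases split <;> simp [secondSelector, xorHeader, Node.preds]
      omega
    · have shifted := W.predsLt.shift (d := W.body.length + 7) (v := W.n + 1)
        (n' := W.n + W.n + 1) (by omega)
      convert shifted using 1
      simp [xorHeader]
      omega
  outs_lt := by
    refine Fin.addCases (fun i => ?_) (fun i => ?_) <;> have := W.outs_lt i
    · simp only [Fin.append_left, List.length_append, List.length_cons, List.length_map, xorHeader,
        List.length_nil]
      omega
    · simp only [Fin.append_right, List.length_append, List.length_cons, List.length_map,
        xorHeader, List.length_nil]
      omega

theorem outs_double (split : Bool) (W : SelectorCircuit) : (W.double split).outs =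
    Fin.append (fun o => W.outs o + 6) (fun o => W.outs o + (W.body.length + 7)) := rfl

theorem ofFn_outs_double (split : Bool) (W : SelectorCircuit) : List.ofFn (W.double split).outs =
    (List.ofFn W.outs).map (· + 6) ++ (List.ofFn W.outs).map (· + (W.body.length + 7)) := by
  simp only [outs_double, List.map_ofFn]
  exact List.ofFn_fin_append _ _

/-- The values of the nodes of `xorHeader`, preceded by the selector `c`, for the random bit `t`. -/
def xorHeaderValues (c t : Bool) : List Bool :=
  [c, t, c && t, !(c && t), c || t, !(c && t) && (c || t)]

theorem values_double (split : Bool) (W : SelectorCircuit) (c t : Bool) (r r' : Fin W.n → Bool) :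
    ((W.double split).circuit c).values
        (Fin.cons t (Fin.append r r') : Fin (W.n + W.n + 1) → Bool) =
      (xorHeaderValues c t ++ (W.circuit (bif split then t else c)).values r) ++
        (W.circuit (bif split then xor c t else c)).values r' := by
  set z : Fin (W.n + W.n + 1) → Bool := Fin.cons t (Fin.append r r') with hz
  have values_header : valuesFrom z [c] (xorHeader W.n) = xorHeaderValues c t := rfl
  have eval_first : (Node.or (firstSelector split) (firstSelector split) :
      Node (W.n + W.n + 1)).eval z (xorHeaderValues c t) = bif split then t else c := by
    cases split <;> simp [firstSelector, Node.eval, xorHeaderValues]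
  have eval_second (v : List Bool) : (Node.or (secondSelector split) (secondSelector split) :
      Node (W.n + W.n + 1)).eval z (xorHeaderValues c t ++ v) =
        bif split then xor c t else c := by
    cases split <;> cases c <;> cases t <;> rfl
  have input_first (i : Fin W.n) : z ⟨i + 1, by omega⟩ = r i := Fin.append_left r r' i
  have input_second (i : Fin W.n) : z ⟨i + (W.n + 1), by omega⟩ = r' i := by
    have index_eq : (⟨i + (W.n + 1), by omega⟩ : Fin (W.n + W.n + 1)) =
        (Fin.natAdd W.n i).succ := by
      ext
      simp only [Fin.val_succ, Fin.val_natAdd]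
      omega
    rw [index_eq, hz, Fin.cons_succ, Fin.append_right]
  simp only [values_circuit, double]
  rw [valuesFrom_append, valuesFrom_append, values_header, valuesFrom_cons z (xorHeaderValues c t),
    eval_first, valuesFrom_shift r _ input_first (d := 6) rfl, valuesFrom_cons, eval_second,
    valuesFrom_shift r' _ input_second (by simp [xorHeaderValues]; omega)]

theorem eval_double (split : Bool) (W : SelectorCircuit) (c t : Bool) (r r' : Fin W.n → Bool) :
    ((W.double split).circuit c).eval (Fin.cons t (Fin.append r r') : Fin (W.n + W.n + 1) → Bool) =
      Fin.append ((W.circuit (bif split then t else c)).eval r)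
        ((W.circuit (bif split then xor c t else c)).eval r') := by
  have length_first : (xorHeaderValues c t ++
      (W.circuit (bif split then t else c)).values r).length = W.body.length + 7 := by
    simp only [xorHeaderValues, values_circuit, List.length_append, length_valuesFrom,
      List.length_cons, List.length_nil]
    omega
  have eval_apply (o : Fin (W.m + W.m)) :
      ((W.double split).circuit c).eval (Fin.cons t (Fin.append r r') : Fin (W.n + W.n + 1) → Bool)
        o = ((xorHeaderValues c t ++ (W.circuit (bif split then t else c)).values r) ++
          (W.circuit (bif split then xor c t else c)).values r').getD
            (Fin.append (fun o => W.outs o + 6) (fun o => W.outs o + (W.body.length + 7)) o)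
            false := by
    rw [← values_double]
    rfl
  refine funext (Fin.addCases (fun i => ?_) fun i => ?_)
  · have := W.outs_lt i
    rw [eval_apply, Fin.append_left, Fin.append_left, List.getD_append _ _ _ _ (by omega),
      getD_append_add (xorHeaderValues c t) _ (d := 6) rfl, eval_circuit_apply]
  · rw [eval_apply, Fin.append_right, Fin.append_right, getD_append_add _ _ length_first,
      eval_circuit_apply]

/-- A measure of the size of a circuit in which the length of its encoding is polynomial. -/
def size (W : SelectorCircuit) : ℕ := W.n + W.m + W.body.length

theorem size_double_le (split : Bool) (W : SelectorCircuit) :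
    (W.double split).size ≤ 2 * W.size + 8 := by
  simp only [size, double, xorHeader, List.length_append, List.length_cons, List.length_nil,
    List.length_map]
  omega

theorem length_flatMap_body_le (W : SelectorCircuit) :
    (W.body.flatMap encodeNode).length ≤ 5 * (W.size + 1) ^ 2 := by
  have body_le : W.body.length ≤ W.size + 1 := by simp only [size]; omega
  have node_le : W.n + 2 * (1 + W.body.length) + 3 ≤ 5 * (W.size + 1) := by
    simp only [size]; omega
  grw [length_flatMap_encodeNode_le W.predsLt le_rfl, node_le, body_le]
  exact le_of_eq (by ring)

theorem length_encodeOutputs_outs_le (W : SelectorCircuit) :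
    (encodeOutputs (List.ofFn W.outs)).length ≤ 2 * (W.size + 1) ^ 2 := by
  have outs_le : ∀ p ∈ List.ofFn W.outs, p < W.body.length + 1 := by
    simpa [List.mem_ofFn] using W.outs_lt
  have m_le : (List.ofFn W.outs).length ≤ W.size + 1 := by
    simp only [List.length_ofFn, size]; omega
  have output_le : W.body.length + 1 + 1 ≤ 2 * (W.size + 1) := by simp only [size]; omega
  grw [length_encodeOutputs_le outs_le, output_le, m_le]
  exact le_of_eq (by ring)

end SelectorCircuit

section Multiplexers

variable {n : ℕ}

/-- For each pair `(p, q)` of positions a multiplexer: three nodes, starting at position `c`, whose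
last one has the value of `q` if the node at position `0` is true, and that of `p` if not. The node
at position `1` has to be the negation of the node at position `0`. -/
def muxNodes (c : ℕ) : List (ℕ × ℕ) → List (Node n)
  | [] => []
  | (p, q) :: L => .and 1 p :: .and 0 q :: .or c (c + 1) :: muxNodes (c + 3) L

@[simp]
theorem length_muxNodes (c : ℕ) (L : List (ℕ × ℕ)) :
    (muxNodes c L : List (Node n)).length = 3 * L.length := by
  induction L generalizing c with
  | nil => rfl
  | cons pq L ih => simp [muxNodes, ih]; omega

theorem predsLt_muxNodes {c : ℕ} {L : List (ℕ × ℕ)} (hc : 1 < c)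
    (hL : ∀ pq ∈ L, pq.1 < c ∧ pq.2 < c) : PredsLt c (muxNodes c L : List (Node n)) := by
  induction L generalizing c with
  | nil => trivial
  | cons pq L ih =>
    simp only [List.mem_cons, forall_eq_or_imp] at hL
    refine ⟨?_, ?_, ?_, ih (by omega) fun r hr => ?_⟩
    · simp [Node.preds]; omega
    · simp [Node.preds]; omega
    · simp [Node.preds]
    · have := hL.2 r hr; omega

theorem getD_valuesFrom_muxNodes {x : Fin n → Bool} {c : Bool} {v w : List Bool}
    {L : List (ℕ × ℕ)} (hv : 2 ≤ v.length) (h0 : v.getD 0 false = c) (h1 : v.getD 1 false = !c)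
    (hL : ∀ pq ∈ L, pq.1 < v.length ∧ pq.2 < v.length) (i : ℕ) (hi : i < L.length) :
    (valuesFrom x (v ++ w) (muxNodes (v ++ w).length L)).getD ((v ++ w).length + 3 * i + 2) false =
      v.getD (bif c then L[i].2 else L[i].1) false := by
  induction L generalizing w i with
  | nil => simp at hi
  | cons pq L ih =>
    obtain ⟨p, q⟩ := pq
    simp only [List.mem_cons, forall_eq_or_imp] at hL
    obtain ⟨⟨hp, hq⟩, hL⟩ := hL
    have getD_v (u : List Bool) {j : ℕ} (hj : j < v.length) :
        (v ++ u).getD j false = v.getD j false := List.getD_append _ _ _ _ hj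
    set block : List Bool := [!c && v.getD p false, c && v.getD q false,
      !c && v.getD p false || c && v.getD q false] with h_block
    have values_eq : valuesFrom x (v ++ w) (muxNodes (v ++ w).length ((p, q) :: L)) =
        valuesFrom x (v ++ (w ++ block)) (muxNodes (v ++ (w ++ block)).length L) := by
      have eval_or (u : List Bool) (a b : Bool) :
          (Node.or u.length (u.length + 1) : Node n).eval x (u ++ [a] ++ [b]) = (a || b) := by
        simp [Node.eval]
      simp only [muxNodes, valuesFrom_cons, eval_or]
      simp only [Node.eval, List.append_assoc, getD_v _ hp, getD_v _ hq,
        getD_v _ (show 0 < v.length by omega), getD_v _ (show 1 < v.length by omega), h0, h1]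
      simp [h_block, add_assoc]
    rw [values_eq]
    cases i with
    | zero =>
      rw [getD_valuesFrom _ (by simp [h_block]; omega), ← List.append_assoc, add_assoc, add_comm,
        getD_append_add _ _ rfl]
      cases c <;> simp [h_block]
    | succ i =>
      rw [List.getElem_cons_succ, ← ih hL i (by simpa using hi) (w := w ++ block)]
      congr 1
      simp [h_block]
      omega

end Multiplexers

namespace CircuitPair

/-- The pairs of the positions, inside `P.selector`, of an output of `P.X` and the corresponding
output of `P.Y`. -/
def outputPairs (P : CircuitPair) : List (ℕ × ℕ) :=
  List.ofFn fun o => (P.X.outputs o + 2, P.Y.outputs o + (P.X.nodes.length + 2))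

@[simp]
theorem length_outputPairs (P : CircuitPair) : P.outputPairs.length = P.m := List.length_ofFn

theorem outputPairs_lt (P : CircuitPair) : ∀ pq ∈ P.outputPairs,
    pq.1 < P.Y.nodes.length + (P.X.nodes.length + 2) ∧
      pq.2 < P.Y.nodes.length + (P.X.nodes.length + 2) := by
  simp only [outputPairs, List.mem_ofFn, forall_exists_index, forall_apply_eq_imp_iff]
  intro o
  have := P.X.outputs_lt o
  have := P.Y.outputs_lt o
  omega

/-- A circuit with a selector that represents the pair `P`: it contains both circuits and a
multiplexer for each output. -/
def selector (P : CircuitPair) : SelectorCircuit where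
  n := P.n
  m := P.m
  body := .not 0 :: (P.X.nodes.map (Node.shift 0 2 le_rfl) ++
    (P.Y.nodes.map (Node.shift 0 (P.X.nodes.length + 2) le_rfl) ++
    muxNodes (P.Y.nodes.length + (P.X.nodes.length + 2)) P.outputPairs))
  outs := fun o => P.Y.nodes.length + (P.X.nodes.length + 2) + 3 * o + 2
  predsLt := by
    refine ⟨by simp [Node.preds], ?_⟩
    simp only [predsLt_append, List.length_map]
    refine ⟨?_, ?_, ?_⟩
    · simpa using P.X.predsLt.shift (d := 2) le_rfl
    · simpa [add_comm] using P.Y.predsLt.shift (d := P.X.nodes.length + 2) le_rfl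
    · convert predsLt_muxNodes _ P.outputPairs_lt using 1 <;> omega
  outs_lt := by
    intro o
    simp only [List.length_cons, List.length_append, List.length_map, length_muxNodes,
      length_outputPairs]
    omega

theorem flatMap_body_selector (P : CircuitPair) : P.selector.body.flatMap encodeNode =
    encodeNode (.not 0 : Node P.n) ++
    ((P.X.nodes.map (Node.shift 0 2 le_rfl)).flatMap encodeNode ++
    ((P.Y.nodes.map (Node.shift 0 (P.X.nodes.length + 2) le_rfl)).flatMap encodeNode ++
    (muxNodes (P.Y.nodes.length + (P.X.nodes.length + 2)) P.outputPairs :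
      List (Node P.n)).flatMap encodeNode)) := by
  simp only [selector, List.flatMap_cons, List.flatMap_append]

theorem ofFn_outs_selector (P : CircuitPair) : List.ofFn P.selector.outs =
    List.range' (P.Y.nodes.length + (P.X.nodes.length + 2) + 2) P.outputPairs.length 3 := by
  refine List.ext_getElem (by simp [selector]) fun i _ _ => ?_
  simp only [selector, List.getElem_ofFn, List.getElem_range']
  omega

theorem values_selector (P : CircuitPair) (c : Bool) (x : Fin P.n → Bool) :
    (P.selector.circuit c).values x = valuesFrom x ([c, !c] ++ P.X.values x ++ P.Y.values x)
      (muxNodes (P.Y.nodes.length + (P.X.nodes.length + 2)) P.outputPairs) := by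
  have values_X := valuesFrom_shift x (x' := x) (k := 0) le_rfl (fun i => rfl)
    (u := [c, !c]) (d := 2) rfl [] P.X.nodes
  have values_Y := valuesFrom_shift x (x' := x) (k := 0) le_rfl (fun i => rfl)
    (u := [c, !c] ++ P.X.values x) (d := P.X.nodes.length + 2)
    (by simp [Circuit.values_eq]) [] P.Y.nodes
  rw [List.append_nil] at values_X values_Y
  simp only [SelectorCircuit.values_circuit, selector, valuesFrom_cons, valuesFrom_append]
  rw [show [c] ++ [(Node.not 0 : Node P.n).eval x [c]] = [c, !c] from rfl, values_X,
    ← Circuit.values_eq, values_Y, ← Circuit.values_eq]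

theorem eval_selector (P : CircuitPair) (c : Bool) :
    (P.selector.circuit c).eval = bif c then P.Y.eval else P.X.eval := by
  refine funext fun (x : Fin P.n → Bool) => funext fun (o : Fin P.m) => ?_
  set v := [c, !c] ++ P.X.values x ++ P.Y.values x with hv
  have length_X : (P.X.values x).length = P.X.nodes.length := by simp [Circuit.values_eq]
  have length_prefix : ([c, !c] ++ P.X.values x).length = P.X.nodes.length + 2 := by
    simp only [List.cons_append, List.nil_append, List.length_cons, length_X]
  have length_v : v.length = P.Y.nodes.length + (P.X.nodes.length + 2) := by
    rw [hv, List.length_append, length_prefix, Circuit.values_eq, length_valuesFrom]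
    simp [add_comm]
  have getD_mux := getD_valuesFrom_muxNodes (x := x) (w := []) (v := v) (L := P.outputPairs)
    (c := c) (by omega) rfl rfl (by simpa only [length_v] using P.outputPairs_lt) o (by simp)
  rw [List.append_nil, length_v, ← values_selector] at getD_mux
  refine getD_mux.trans ?_
  have getElem_outputPairs : P.outputPairs[(o : ℕ)]'(by simp) =
      (P.X.outputs o + 2, P.Y.outputs o + (P.X.nodes.length + 2)) := by simp [outputPairs]
  have := P.X.outputs_lt o
  rw [getElem_outputPairs]
  cases c
  · rw [cond_false, cond_false, hv, List.getD_append _ _ _ _ (by omega),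
      getD_append_add [false, !false] _ (d := 2) rfl]
    rfl
  · rw [cond_true, cond_true, hv, getD_append_add _ _ length_prefix]
    rfl

theorem length_encodePair (P : CircuitPair) : (encodePair P).length =
    P.n + (P.X.nodes.flatMap encodeNode).length + (encodeOutputs (List.ofFn P.X.outputs)).length +
    (P.Y.nodes.flatMap encodeNode).length + (encodeOutputs (List.ofFn P.Y.outputs)).length + 3 := by
  simp only [encodePair, encodeCircuit_eq, encodeUnary, List.length_append, List.length_replicate,
    List.length_cons, List.length_nil]
  omega

theorem size_selector_le (P : CircuitPair) : P.selector.size ≤ (encodePair P).length := by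
  have nodes_X := length_le_length_flatMap_encodeNode P.X.nodes
  have nodes_Y := length_le_length_flatMap_encodeNode P.Y.nodes
  have outputs_X := two_mul_length_le_length_encodeOutputs (List.ofFn P.X.outputs)
  have outputs_Y := two_mul_length_le_length_encodeOutputs (List.ofFn P.Y.outputs)
  rw [length_encodePair]
  simp only [List.length_ofFn] at outputs_X outputs_Y
  simp only [SelectorCircuit.size, selector, List.length_cons, List.length_append, List.length_map,
    length_muxNodes, length_outputPairs]
  omega

end CircuitPair

/-- The stacks of the machine. The stacks `inputCount` and `param`, and the auxiliary counters, hold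
numbers in unary. -/
inductive Stack : Type
  | input | output | inputCount | param | remaining | nodes | outputs | newNodes | newOutputs
  | saved | scratch | varShift | posShift | offset | position | parity
  deriving DecidableEq

instance : Fintype Stack where
  elems := {.input, .output, .inputCount, .param, .remaining, .nodes, .outputs, .newNodes,
    .newOutputs, .saved, .scratch, .varShift, .posShift, .offset, .position, .parity}
  complete k := by cases k <;> decide

/-- The programs of the machine: they work on the letters of the encodings, so that both input and
output are single stacks. -/
abbrev Program : Type := StackProgram Stack Letter

/-- A number in unary, as it is kept on a stack. -/
abbrev ticks (k : ℕ) : List Letter := List.replicate k .tick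

namespace Program

open Function StackProgram Stack

variable {n n' : ℕ} {s : Stack → List Letter}

theorem encodeUnary_eq (k : ℕ) : encodeUnary k = ticks k ++ [.comma] := rfl

theorem ticks_append_cons (k : ℕ) (l : List Letter) :
    ticks k ++ .tick :: l = .tick :: (ticks k ++ l) := by
  rw [List.append_cons, ← List.replicate_succ', List.replicate_succ, List.cons_append]

/-- One letter of a node in transit to `newNodes`, see `Node.shift`. A number grows at its comma, by
the `offset` that the letter at the beginning of the node has set. -/
def shiftNodeLetter : Letter → Program
  | .comma => copy scratch offset newNodes ;; push newNodes .comma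
  | .var => load scratch varShift offset ;; push position .tick ;; push newNodes .var
  | .tick => push newNodes .tick
  | .tt => push position .tick ;; push newNodes .tt
  | .ff => push position .tick ;; push newNodes .ff
  | a => load scratch posShift offset ;; push position .tick ;; push newNodes a

/-- One letter of an output in transit to `newOutputs`, with `posShift` added to its position. -/
def shiftOutputLetter : Letter → Program
  | .comma => copy scratch posShift newOutputs ;; push newOutputs .comma
  | a => push newOutputs a

section Shift

variable {v d : ℕ}

theorem foldl_shiftNodeLetter_encodeUnary (h_scratch : s scratch = [])
    (h_offset : s offset = ticks d) (p : ℕ) :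
    (encodeUnary p).foldl (fun s a => (shiftNodeLetter a).exec s) s =
      update s newNodes ((encodeUnary (p + d)).reverse ++ s newNodes) := by
  induction p generalizing s with
  | zero => simp [encodeUnary, shiftNodeLetter, h_scratch, h_offset]
  | succ p ih =>
    rw [encodeUnary, List.replicate_succ, List.cons_append, List.foldl_cons, ← encodeUnary, ih]
    · simp [shiftNodeLetter, encodeUnary_eq, Nat.succ_add, List.replicate_succ, ticks_append_cons]
    · simp [shiftNodeLetter, h_scratch]
    · simp [shiftNodeLetter, h_offset]

theorem foldl_shiftNodeLetter_encodeNode (hv : n + v ≤ n') (h_scratch : s scratch = [])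
    (h_var : s varShift = ticks v) (h_pos : s posShift = ticks d) (g : Node n) :
    ∃ o, (encodeNode g).foldl (fun s a => (shiftNodeLetter a).exec s) s =
      update (update (update s offset o) position (.tick :: s position))
        newNodes ((encodeNode (g.shift v d hv)).reverse ++ s newNodes) := by
  rcases g with i | (_ | _) | p | ⟨p, q⟩ | ⟨p, q⟩
  case const.false | const.true =>
    exact ⟨s offset, by simp [encodeNode, Node.shift, shiftNodeLetter]⟩
  case var =>
    refine ⟨ticks v, ?_⟩
    rw [encodeNode, List.foldl_cons, foldl_shiftNodeLetter_encodeUnary (d := v)] <;>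
      simp [encodeNode, Node.shift, shiftNodeLetter, h_scratch, h_var]
  case not =>
    refine ⟨ticks d, ?_⟩
    rw [encodeNode, List.foldl_cons, foldl_shiftNodeLetter_encodeUnary (d := d)] <;>
      simp [encodeNode, Node.shift, shiftNodeLetter, h_scratch, h_pos]
  case and | or =>
    refine ⟨ticks d, ?_⟩
    have foldl_first {t : Stack → List Letter} (ht : t scratch = []) (ht' : t offset = ticks d) :=
      foldl_shiftNodeLetter_encodeUnary ht ht' p
    rw [encodeNode, List.foldl_cons, List.foldl_append, foldl_first,
      foldl_shiftNodeLetter_encodeUnary (d := d)] <;>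
      simp [encodeNode, Node.shift, shiftNodeLetter, h_scratch, h_pos]

theorem foldl_shiftNodeLetter (hv : n + v ≤ n') (h_scratch : s scratch = [])
    (h_var : s varShift = ticks v) (h_pos : s posShift = ticks d) (L : List (Node n)) :
    ∃ o, (L.flatMap encodeNode).foldl (fun s a => (shiftNodeLetter a).exec s) s =
      update (update (update s offset o) position (ticks L.length ++ s position))
        newNodes (((L.map (Node.shift v d hv)).flatMap encodeNode).reverse ++ s newNodes) := by
  induction L generalizing s with
  | nil => exact ⟨s offset, by simp⟩
  | cons g L ih =>
    obtain ⟨o, exec_g⟩ := foldl_shiftNodeLetter_encodeNode hv h_scratch h_var h_pos g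
    rw [List.flatMap_cons, List.foldl_append, exec_g]
    obtain ⟨o', exec_L⟩ := ih (s := update (update (update s offset o) position
      (.tick :: s position)) newNodes ((encodeNode (g.shift v d hv)).reverse ++ s newNodes))
      (by simpa) (by simpa) (by simpa)
    refine ⟨o', exec_L.trans ?_⟩
    funext j
    cases j <;> simp [ticks_append_cons, List.replicate_succ]

theorem foldl_shiftOutputLetter (h_scratch : s scratch = []) (h_pos : s posShift = ticks d)
    (L : List ℕ) : (encodeOutputs L).foldl (fun s a => (shiftOutputLetter a).exec s) s =
      update s newOutputs ((encodeOutputs (L.map (· + d))).reverse ++ s newOutputs) := by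
  have foldl_encodeUnary (p : ℕ) : ∀ {s : Stack → List Letter}, s scratch = [] →
      s posShift = ticks d →
      (encodeUnary p).foldl (fun s a => (shiftOutputLetter a).exec s) s =
        update s newOutputs ((encodeUnary (p + d)).reverse ++ s newOutputs) := by
    induction p with
    | zero =>
      intro s h_scratch h_pos
      simp [encodeUnary, shiftOutputLetter, h_scratch, h_pos]
    | succ p ih =>
      intro s h_scratch h_pos
      rw [encodeUnary, List.replicate_succ, List.cons_append, List.foldl_cons, ← encodeUnary, ih]
      · simp [shiftOutputLetter, encodeUnary_eq, Nat.succ_add, List.replicate_succ,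
          ticks_append_cons]
      · simp [shiftOutputLetter, h_scratch]
      · simp [shiftOutputLetter, h_pos]
  induction L generalizing s with
  | nil => simp [encodeOutputs]
  | cons p L ih =>
    simp only [encodeOutputs, List.flatMap_cons, List.foldl_append, List.foldl_cons] at ih ⊢
    rw [foldl_encodeUnary, ih] <;> simp [shiftOutputLetter, h_scratch, h_pos]

end Shift

end Program

namespace Program

open Function StackProgram Stack

variable {s : Stack → List Letter} {D : ℕ}

/-- The numbers that `shiftNodeLetter` and `shiftOutputLetter` add are at most `D`. -/
def ShiftBounded (D : ℕ) (s : Stack → List Letter) : Prop :=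
  s scratch = [] ∧ (s varShift).length ≤ D ∧ (s posShift).length ≤ D ∧ (s offset).length ≤ D

theorem ShiftBounded.exec_shiftNodeLetter (hs : ShiftBounded D s) (a : Letter) :
    ShiftBounded D ((shiftNodeLetter a).exec s) := by
  obtain ⟨h_scratch, h_var, h_pos, h_offset⟩ := hs
  cases a <;> simp [ShiftBounded, shiftNodeLetter, h_scratch, h_var, h_pos, h_offset]

theorem ShiftBounded.exec_shiftOutputLetter (hs : ShiftBounded D s) (a : Letter) :
    ShiftBounded D ((shiftOutputLetter a).exec s) := by
  obtain ⟨h_scratch, h_var, h_pos, h_offset⟩ := hs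
  cases a <;> simp [ShiftBounded, shiftOutputLetter, h_scratch, h_var, h_pos, h_offset]

theorem ShiftBounded.loopTime_shiftNodeLetter_le (hs : ShiftBounded D s) (L : List Letter) :
    loopTime (fun s a => (shiftNodeLetter a).exec s) (fun a => (shiftNodeLetter a).time) L s ≤
      1 + L.length * (1 + (7 * D + 5)) := by
  refine loopTime_le (fun _ => ShiftBounded D) (fun a s _ hs => hs.exec_shiftNodeLetter a) ?_ L hs
  rintro a s - ⟨h_scratch, h_var, h_pos, h_offset⟩
  cases a <;> simp [shiftNodeLetter, h_scratch] <;> omega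

theorem ShiftBounded.loopTime_shiftOutputLetter_le (hs : ShiftBounded D s) (L : List Letter) :
    loopTime (fun s a => (shiftOutputLetter a).exec s) (fun a => (shiftOutputLetter a).time) L s ≤
      1 + L.length * (1 + (5 * D + 3)) := by
  refine loopTime_le (fun _ => ShiftBounded D) (fun a s _ hs => hs.exec_shiftOutputLetter a) ?_ L hs
  rintro a s - ⟨h_scratch, -, h_pos, -⟩
  cases a <;> simp [shiftOutputLetter, h_scratch]
  omega

/-- Appends a copy of the nodes on `nodes`, shifted by `varShift` and `posShift`, to `newNodes`. -/
def shiftNodes : Program :=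
  copy scratch nodes saved ;; forAll saved shiftNodeLetter ;; clear offset

/-- Appends a copy of the outputs on `outputs`, shifted by `posShift`, to `newOutputs`. -/
def shiftOutputs : Program :=
  copy scratch outputs saved ;; forAll saved shiftOutputLetter

theorem exec_shiftNodes {n n' v d : ℕ} (hv : n + v ≤ n') {L : List (Node n)}
    (h_scratch : s scratch = []) (h_saved : s saved = []) (h_offset : s offset = [])
    (h_var : s varShift = ticks v) (h_pos : s posShift = ticks d)
    (h_nodes : s nodes = L.flatMap encodeNode) :
    shiftNodes.exec s = update (update s position (ticks L.length ++ s position))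
      newNodes (((L.map (Node.shift v d hv)).flatMap encodeNode).reverse ++ s newNodes) := by
  obtain ⟨o, exec_nodes⟩ := foldl_shiftNodeLetter hv
    (s := update s saved (L.flatMap encodeNode)) (d := d) (by simp [h_scratch])
    (by simp [h_var]) (by simp [h_pos]) L
  funext j
  cases j <;> simp [shiftNodes, exec_nodes, h_scratch, h_saved, h_nodes, h_offset]

theorem time_shiftNodes_le (hs : ShiftBounded D s) (h_saved : s saved = []) :
    shiftNodes.time s ≤ (s nodes).length * (7 * D + 11) + 2 * D + 4 := by
  have bounded : ShiftBounded D (update s saved (s nodes)) := by simpa [ShiftBounded] using hs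
  have loop := bounded.loopTime_shiftNodeLetter_le (s nodes)
  have offset_le : ((s nodes).foldl (fun s a => (shiftNodeLetter a).exec s)
      (update s saved (s nodes)) offset).length ≤ D :=
    (List.foldlRecOn (s nodes) _ bounded fun s hs a _ => hs.exec_shiftNodeLetter a).2.2.2
  simp only [shiftNodes, time, time_copy _ hs.1, time_forAll, time_clear, exec_forAll,
    exec_copy _ hs.1, ne_eq, reduceCtorEq, not_false_eq_true, h_saved, List.append_nil, update_self,
    update_of_ne]
  nlinarith

theorem time_shiftOutputs_le (hs : ShiftBounded D s) (h_saved : s saved = []) :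
    shiftOutputs.time s ≤ (s outputs).length * (5 * D + 9) + 3 := by
  have bounded : ShiftBounded D (update s saved (s outputs)) := by simpa [ShiftBounded] using hs
  have loop := bounded.loopTime_shiftOutputLetter_le (s outputs)
  simp only [shiftOutputs, time, time_copy _ hs.1, time_forAll, exec_copy _ hs.1, ne_eq,
    reduceCtorEq, not_false_eq_true, h_saved, List.append_nil, update_self]
  nlinarith

theorem exec_shiftOutputs {d : ℕ} {L : List ℕ} (h_scratch : s scratch = []) (h_saved : s saved = [])
    (h_pos : s posShift = ticks d) (h_outputs : s outputs = encodeOutputs L) :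
    shiftOutputs.exec s =
      update s newOutputs ((encodeOutputs (L.map (· + d))).reverse ++ s newOutputs) := by
  have exec_outputs := foldl_shiftOutputLetter (s := update s saved (encodeOutputs L)) (d := d)
    (by simp [h_scratch]) (by simp [h_pos]) L
  funext j
  cases j <;> simp [shiftOutputs, exec_outputs, h_scratch, h_saved, h_outputs]

theorem exec_shiftNodes_shiftOutputs {n n' v d : ℕ} (hv : n + v ≤ n') {body : List (Node n)}
    {L : List ℕ} (h_scratch : s scratch = []) (h_saved : s saved = []) (h_offset : s offset = [])
    (h_var : s varShift = ticks v) (h_pos : s posShift = ticks d)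
    (h_nodes : s nodes = body.flatMap encodeNode) (h_outputs : s outputs = encodeOutputs L) :
    shiftOutputs.exec (shiftNodes.exec s) = update (update (update s
      position (ticks body.length ++ s position))
      newNodes (((body.map (Node.shift v d hv)).flatMap encodeNode).reverse ++ s newNodes))
      newOutputs ((encodeOutputs (L.map (· + d))).reverse ++ s newOutputs) := by
  rw [exec_shiftNodes hv h_scratch h_saved h_offset h_var h_pos h_nodes,
    exec_shiftOutputs (L := L) (d := d)] <;> simp [*]

theorem time_shiftNodes_shiftOutputs_le {n v d : ℕ} {body : List (Node n)} {L : List ℕ}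
    (h_scratch : s scratch = []) (h_saved : s saved = []) (h_offset : s offset = [])
    (h_var : s varShift = ticks v) (h_pos : s posShift = ticks d)
    (h_nodes : s nodes = body.flatMap encodeNode) (h_outputs : s outputs = encodeOutputs L)
    (hvD : v ≤ D) (hdD : d ≤ D) :
    shiftNodes.time s + shiftOutputs.time (shiftNodes.exec s) ≤
      (body.flatMap encodeNode).length * (7 * D + 11) +
        (encodeOutputs L).length * (5 * D + 9) + 2 * D + 7 := by
  have exec_nodes := exec_shiftNodes (n' := n + v) le_rfl h_scratch h_saved h_offset h_var h_pos
    h_nodes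
  have time_nodes := time_shiftNodes_le (D := D)
    (by simp [ShiftBounded, h_scratch, h_var, h_pos, h_offset, hvD, hdD]) h_saved
  have time_outputs := time_shiftOutputs_le (s := shiftNodes.exec s) (D := D)
    (by simp [ShiftBounded, exec_nodes, h_scratch, h_var, h_pos, h_offset, hvD, hdD])
    (by simp [exec_nodes, h_saved])
  have outputs_eq : shiftNodes.exec s outputs = encodeOutputs L := by simp [exec_nodes, h_outputs]
  rw [h_nodes] at time_nodes
  rw [outputs_eq] at time_outputs
  omega

end Program

namespace Program

open Function StackProgram Stack SelectorCircuit

/-- The stacks between two passes of the machine: a circuit with a selector, the parameter `k` and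
a counter with the value `c`. -/
def store (W : SelectorCircuit) (k c : ℕ) : Stack → List Letter
  | inputCount => ticks W.n
  | nodes => W.body.flatMap encodeNode
  | outputs => encodeOutputs (List.ofFn W.outs)
  | param => ticks k
  | remaining => ticks c
  | input | output | newNodes | newOutputs | saved | scratch | varShift | posShift | offset
  | position | parity => []

/-- The stacks while a new circuit is being built from `W`: the nodes `N` and the outputs `O` of the
new circuit, both in reverse, the position `d` of its next node, and the shifts `v` and `p`. -/
def building (W : SelectorCircuit) (k c v d p : ℕ) (N O : List Letter) : Stack → List Letter :=
  update (update (update (update (update (store W k c) newNodes N) newOutputs O)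
    varShift (ticks v)) position (ticks d)) posShift (ticks p)

section Building

variable (split : Bool) (W : SelectorCircuit) (k c v d p q : ℕ) (N O : List Letter)

/-- Appends to `newNodes` and `newOutputs` a copy of the circuit on `nodes` and `outputs` that takes
its selector from position `q`. -/
def copyPass (q : ℕ) : Program :=
  load scratch position posShift ;;
  pushAll newNodes (encodeNode (.or q q : Node 0)) ;; push position .tick ;;
  shiftNodes ;; shiftOutputs

theorem exec_copyPass {n' : ℕ} (hv : W.n + v ≤ n') :
    (copyPass q).exec (building W k c v d p N O) =
      building W k c v (W.body.length + 1 + d) d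
        (((.or q q :: W.body.map (Node.shift v d hv)).flatMap encodeNode).reverse ++ N)
        ((encodeOutputs ((List.ofFn W.outs).map (· + d))).reverse ++ O) := by
  have encode_or : encodeNode (.or q q : Node 0) = encodeNode (.or q q : Node n') := rfl
  have position_eq : ticks (W.body.length + 1 + d) = ticks W.body.length ++ .tick :: ticks d := by
    simp [← List.replicate_append_replicate, List.replicate_succ']
  simp only [copyPass, exec]
  rw [exec_shiftNodes_shiftOutputs hv (body := W.body) (L := List.ofFn W.outs) (d := d)]
  · funext j
    cases j <;> simp [building, store, encode_or, position_eq]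
  all_goals simp [building, store]

theorem time_copyPass_le (hv : v ≤ 7 * (W.size + 1)) (hd : d ≤ 7 * (W.size + 1))
    (hp : p ≤ 7 * (W.size + 1)) (hq : q ≤ 5) :
    (copyPass q).time (building W k c v d p N O) ≤ 480 * (W.size + 1) ^ 3 := by
  set M := W.size + 1 with hM
  set s := (load scratch position posShift ;; pushAll newNodes (encodeNode (.or q q : Node 0)) ;;
    push position .tick).exec (building W k c v d p N O) with hs
  have time_shift : shiftNodes.time s + shiftOutputs.time (shiftNodes.exec s) ≤ _ :=
    time_shiftNodes_shiftOutputs_le (v := v) (d := d) (body := W.body) (L := List.ofFn W.outs)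
      (by simp [hs, building, store]) (by simp [hs, building, store])
      (by simp [hs, building, store]) (by simp [hs, building, store])
      (by simp [hs, building, store]) (by simp [hs, building, store])
      (by simp [hs, building, store]) hv hd
  have time_eq : (copyPass q).time (building W k c v d p N O) = 3 + d * 5 + p * 2 + (2 * q + 4) +
      1 + (shiftNodes.time s + shiftOutputs.time (shiftNodes.exec s)) := by
    simp [copyPass, building, store, hs, encodeNode, encodeUnary]
    omega
  have nodes_le := Nat.mul_le_mul_right (7 * (7 * M) + 11) W.length_flatMap_body_le
  have outs_le := Nat.mul_le_mul_right (5 * (7 * M) + 9) W.length_encodeOutputs_outs_le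
  have M_le_sq : M ≤ M ^ 2 := Nat.le_self_pow two_ne_zero M
  have sq_le_cube : M ^ 2 ≤ M ^ 3 := Nat.pow_le_pow_right (by omega) (by omega)
  rw [← hM] at nodes_le outs_le
  ring_nf at nodes_le outs_le time_shift ⊢
  omega

/-- Replaces the circuit on `nodes` and `outputs` by the one on `newNodes` and `newOutputs`, with
`varShift` more inputs. -/
def commit : Program :=
  clear nodes ;; moveAll newNodes nodes ;; clear outputs ;; moveAll newOutputs outputs ;;
  clear position ;; clear posShift ;; moveAll varShift inputCount

theorem exec_commit {V : SelectorCircuit} (hV : W.n + v = V.n) :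
    commit.exec (building W k c v d p (V.body.flatMap encodeNode).reverse
      (encodeOutputs (List.ofFn V.outs)).reverse) = store V k c := by
  funext j
  cases j <;> simp [commit, building, store, ← hV, add_comm]

theorem time_commit : commit.time (building W k c v d p N O) =
    7 + 2 * ((W.body.flatMap encodeNode).length + (encodeOutputs (List.ofFn W.outs)).length +
      N.length + O.length + d + p + v) := by
  simp [commit, building, store]
  omega

/-- Writes the nodes of `xorHeader` and sets up the shifts for the first copy. -/
def header : Program :=
  pushAll newNodes ((xorHeader 0).flatMap encodeNode) ;; pushAll position (ticks 6) ;;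
  push varShift .tick

theorem exec_header : header.exec (store W k c) =
    building W k c 1 6 0 ((xorHeader W.n).flatMap encodeNode).reverse [] := by
  have header_eq : (xorHeader 0).flatMap encodeNode = (xorHeader W.n).flatMap encodeNode := rfl
  funext j
  cases j <;> simp [header, building, store, header_eq]
  rfl

theorem time_header (s : Stack → List Letter) : header.time s = 33 := by
  simp [header, xorHeader, encodeNode, encodeUnary]

/-- The program for `SelectorCircuit.double`. -/
def double : Program :=
  header ;; copyPass (firstSelector split) ;;
  copy scratch inputCount varShift ;; copyPass (secondSelector split) ;; commit

theorem exec_copy_inputCount : (copy scratch inputCount varShift).exec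
    (building W k c v d p N O) = building W k c (W.n + v) d p N O := by
  funext j
  cases j <;> simp [building, store]

theorem exec_copies :
    (copyPass (secondSelector split)).exec ((copy scratch inputCount varShift).exec
      ((copyPass (firstSelector split)).exec
        (building W k c 1 6 0 ((xorHeader W.n).flatMap encodeNode).reverse []))) =
    building W k c (W.n + 1) (W.body.length + 1 + (W.body.length + 7)) (W.body.length + 7)
      ((W.double split).body.flatMap encodeNode).reverse
      (encodeOutputs (List.ofFn (W.double split).outs)).reverse := by
  rw [exec_copyPass W _ _ _ _ _ _ _ _ (n' := W.n + W.n + 1) (by omega), exec_copy_inputCount,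
    exec_copyPass W _ _ _ _ _ _ _ _ (n' := W.n + W.n + 1) (by omega), ofFn_outs_double]
  simp [SelectorCircuit.double, encodeOutputs, add_assoc]

theorem exec_double : (double split).exec (store W k c) = store (W.double split) k c := by
  simp only [double, exec]
  rw [exec_header, exec_copies, exec_commit]
  simp only [SelectorCircuit.double]
  omega

theorem time_copy_inputCount : (copy scratch inputCount varShift).time
    (building W k c v d p N O) = 2 + W.n * 5 := by
  simp [building, store]

theorem time_double_le : (double split).time (store W k c) ≤ 2500 * (W.size + 1) ^ 3 := by
  set M := W.size + 1 with hM
  have M_le_sq : M ≤ M ^ 2 := Nat.le_self_pow two_ne_zero M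
  have sq_le_cube : M ^ 2 ≤ M ^ 3 := Nat.pow_le_pow_right (by omega) (by omega)
  have n_le : W.n + 1 ≤ M := by simp only [hM, size]; omega
  have body_le : W.body.length + 1 ≤ M := by simp only [hM, size]; omega
  have selector_le : firstSelector split ≤ 1 ∧ secondSelector split ≤ 5 := by
    cases split <;> simp [firstSelector, secondSelector]
  have time_first := time_copyPass_le W k c 1 6 0 (firstSelector split)
    ((xorHeader W.n).flatMap encodeNode).reverse [] (by omega) (by omega) (by omega) (by omega)
  have time_second := fun N O => time_copyPass_le W k c (W.n + 1) (W.body.length + 1 + 6) 6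
    (secondSelector split) N O (by omega) (by omega) (by omega) (by omega)
  have size_sq_le : ((W.double split).size + 1) ^ 2 ≤ 81 * M ^ 2 :=
    (Nat.pow_le_pow_left (by have := size_double_le split W; omega) 2).trans_eq (mul_pow 9 M 2)
  have nodes_le := W.length_flatMap_body_le
  have outs_le := W.length_encodeOutputs_outs_le
  have new_nodes_le := (W.double split).length_flatMap_body_le
  have new_outs_le := (W.double split).length_encodeOutputs_outs_le
  rw [← hM] at nodes_le outs_le time_first time_second
  simp only [double, time]
  rw [exec_header, exec_copies, time_header, time_commit, List.length_reverse, List.length_reverse,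
    exec_copyPass W _ _ _ _ _ _ _ _ (n' := W.n + W.n + 1) (by omega), exec_copy_inputCount,
    time_copy_inputCount]
  grw [time_first, time_second]
  omega

end Building

end Program

namespace Program

open Function StackProgram Stack SelectorCircuit

section ReadCircuit

variable {s : Stack → List Letter} {n m : ℕ} {C : Circuit n m}

/-- Consumes the nodes of an encoded circuit and appends them, in reverse, to `newNodes`, with the
number on `position` added to their positions. -/
def readNodes : Program :=
  load scratch position posShift ;;
  forEach input (fun a => a != .out && a != .fin) shiftNodeLetter ;; clear offset

/-- Consumes the outputs of an encoded circuit and puts them on `j`, with the number on `posShift`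
added. -/
def readOutputs (j : Stack) : Program :=
  forEach input (fun a => a != .fin) shiftOutputLetter ;; moveAll newOutputs j ;;
  pop input fun _ => skip

theorem ne_out_and_ne_fin_of_mem_encodeNodes {L : List (Node n)} :
    ∀ a ∈ L.flatMap encodeNode, (a != .out && a != .fin) = true := by
  simp only [List.mem_flatMap, forall_exists_index, and_imp]
  rintro a (i | (_ | _) | p | ⟨p, q⟩ | ⟨p, q⟩) - ha <;>
    simp only [encodeNode, encodeUnary, List.mem_cons, List.mem_append, List.mem_replicate,
      List.not_mem_nil] at ha <;>
    aesop

theorem ne_fin_of_mem_encodeOutputs {L : List ℕ} :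
    ∀ a ∈ encodeOutputs L, (a != .fin) = true := by
  simp only [encodeOutputs, List.mem_flatMap, forall_exists_index, and_imp]
  rintro a p - ha
  simp only [encodeUnary, List.mem_cons, List.mem_append, List.mem_replicate,
      List.not_mem_nil] at ha
  aesop

theorem takeWhile_encodeCircuit (rest : List Letter) :
    (encodeCircuit C ++ rest).takeWhile (fun a => a != .out && a != .fin) =
      C.nodes.flatMap encodeNode := by
  rw [encodeCircuit_eq, List.append_assoc, List.append_assoc,
    List.takeWhile_append_of_pos ne_out_and_ne_fin_of_mem_encodeNodes]
  cases List.ofFn C.outputs <;> simp [encodeOutputs]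

theorem dropWhile_encodeCircuit (rest : List Letter) :
    (encodeCircuit C ++ rest).dropWhile (fun a => a != .out && a != .fin) =
      encodeOutputs (List.ofFn C.outputs) ++ .fin :: rest := by
  rw [encodeCircuit_eq, List.append_assoc, List.append_assoc,
    List.dropWhile_append_of_pos ne_out_and_ne_fin_of_mem_encodeNodes]
  cases List.ofFn C.outputs <;> simp [encodeOutputs]

theorem takeWhile_encodeOutputs (L : List ℕ) (rest : List Letter) :
    (encodeOutputs L ++ .fin :: rest).takeWhile (fun a => a != .fin) = encodeOutputs L := by
  rw [List.takeWhile_append_of_pos ne_fin_of_mem_encodeOutputs]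
  simp

theorem dropWhile_encodeOutputs (L : List ℕ) (rest : List Letter) :
    (encodeOutputs L ++ .fin :: rest).dropWhile (fun a => a != .fin) = .fin :: rest := by
  rw [List.dropWhile_append_of_pos ne_fin_of_mem_encodeOutputs]
  simp

theorem exec_readNodes {d : ℕ} {rest : List Letter} (h_scratch : s scratch = [])
    (h_var : s varShift = []) (h_offset : s offset = []) (h_position : s position = ticks d)
    (h_input : s input = encodeCircuit C ++ rest) :
    readNodes.exec s = update (update (update (update s
      posShift (ticks d)) position (ticks (C.nodes.length + d)))
      newNodes (((C.nodes.map (Node.shift 0 d le_rfl)).flatMap encodeNode).reverse ++ s newNodes))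
      input (encodeOutputs (List.ofFn C.outputs) ++ .fin :: rest) := by
  obtain ⟨o, exec_nodes⟩ := foldl_shiftNodeLetter (n' := n) (v := 0) (d := d) le_rfl
    (s := update s posShift (ticks d)) (by simp [h_scratch]) (by simp [h_var]) (by simp) C.nodes
  funext x
  cases x <;>
    simp [readNodes, h_scratch, h_input, h_position, takeWhile_encodeCircuit,
      dropWhile_encodeCircuit, exec_nodes, h_offset]

theorem exec_readOutputs {j : Stack} (hj : j ≠ newOutputs) (hj' : j ≠ input) {d : ℕ} {L : List ℕ}
    {rest : List Letter} (h_scratch : s scratch = []) (h_new : s newOutputs = [])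
    (h_pos : s posShift = ticks d) (h_input : s input = encodeOutputs L ++ .fin :: rest) :
    (readOutputs j).exec s =
      update (update s j (encodeOutputs (L.map (· + d)) ++ s j)) input rest := by
  have exec_outputs := foldl_shiftOutputLetter h_scratch h_pos L
  funext x
  by_cases hx : x = j <;> cases x <;>
    simp_all [readOutputs, takeWhile_encodeOutputs, dropWhile_encodeOutputs, hj.symm, hj'.symm]

theorem length_encodeOutputs_map_add (L : List ℕ) (d : ℕ) :
    (encodeOutputs (L.map (· + d))).length = (encodeOutputs L).length + L.length * d := by
  induction L with
  | nil => simp [encodeOutputs]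
  | cons p L ih =>
    simp only [encodeOutputs, encodeUnary, List.map_cons, List.flatMap_cons, List.length_append,
      List.length_cons, List.length_replicate] at ih ⊢
    rw [ih]
    ring

theorem time_readNodes_le {D : ℕ} {rest : List Letter} (hs : ShiftBounded D s)
    (h_position : (s position).length ≤ D) (h_input : s input = encodeCircuit C ++ rest) :
    readNodes.time s ≤ (C.nodes.flatMap encodeNode).length * (7 * D + 6) + 9 * D + 5 := by
  have bounded : ShiftBounded D (update s posShift (s position)) := by
    simpa [ShiftBounded, h_position] using ⟨hs.1, hs.2.1, hs.2.2.2⟩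
  have loop := bounded.loopTime_shiftNodeLetter_le (C.nodes.flatMap encodeNode)
  have offset_le : (((C.nodes.flatMap encodeNode)).foldl (fun s a => (shiftNodeLetter a).exec s)
      (update s posShift (s position)) offset).length ≤ D :=
    (List.foldlRecOn _ _ bounded fun s hs a _ => hs.exec_shiftNodeLetter a).2.2.2
  have pos_le := hs.2.2.1
  simp only [readNodes, time, exec, time_load _ hs.1, exec_load _ hs.1, time_clear, ne_eq,
    reduceCtorEq, not_false_eq_true, update_of_ne, h_input, takeWhile_encodeCircuit]
  nlinarith

theorem time_readOutputs_le {D d : ℕ} {j : Stack} {L : List ℕ} {rest : List Letter}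
    (hs : ShiftBounded D s) (h_new : s newOutputs = []) (h_pos : s posShift = ticks d)
    (h_input : s input = encodeOutputs L ++ .fin :: rest) :
    (readOutputs j).time s ≤ (encodeOutputs L).length * (7 * D + 6) + 4 := by
  have loop := hs.loopTime_shiftOutputLetter_le (encodeOutputs L)
  have d_le : d ≤ D := by simpa [h_pos] using hs.2.2.1
  have length_le := two_mul_length_le_length_encodeOutputs L
  simp only [readOutputs, time, exec, time_moveAll, h_input, takeWhile_encodeOutputs, ne_eq,
    reduceCtorEq, not_false_eq_true, update_of_ne, foldl_shiftOutputLetter hs.1 h_pos, update_self,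
    h_new, List.length_reverse, List.append_nil, length_encodeOutputs_map_add]
  nlinarith

end ReadCircuit

end Program

namespace Program

open Function StackProgram Stack SelectorCircuit

section Multiplexers

variable {s : Stack → List Letter} {c : ℕ}

/-- One letter of an output position of the second circuit, while the multiplexers of
`CircuitPair.selector` are built: at the beginning of the position the first two nodes are written
up to that position, with the output position of the first circuit taken from `outputs`, and at its
end the third node and the new output. -/
def muxLetter : Letter → Program
  | .out =>
    pushAll newNodes [.and, .tick, .comma] ;; (pop outputs fun _ => skip) ;;
    moveWhile (· == .tick) outputs newNodes ;; (pop outputs fun _ => skip) ;;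
    pushAll newNodes [.comma, .and, .comma]
  | .comma =>
    pushAll newNodes [.comma, .or] ;; copy scratch position newNodes ;; push newNodes .comma ;;
    copy scratch position newNodes ;; pushAll newNodes [.tick, .comma] ;; push newOutputs .out ;;
    copy scratch position newOutputs ;; pushAll newOutputs [.tick, .tick, .comma] ;;
    pushAll position (ticks 3)
  | a => push newNodes a

theorem foldl_muxLetter_ticks (q : ℕ) : (ticks q).foldl (fun s a => (muxLetter a).exec s) s =
    update s newNodes (ticks q ++ s newNodes) := by
  induction q generalizing s with
  | zero => simp
  | succ q ih =>
    rw [ticks, List.replicate_succ, List.foldl_cons, ih]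
    simp [muxLetter, ticks_append_cons]

theorem foldl_muxLetter_single {n p q : ℕ} {L : List ℕ} (h_scratch : s scratch = [])
    (h_position : s position = ticks c) (h_outputs : s outputs = encodeOutputs (p :: L)) :
    (Letter.out :: encodeUnary q).foldl (fun s a => (muxLetter a).exec s) s =
      update (update (update (update s outputs (encodeOutputs L)) position (ticks (c + 3)))
        newNodes (((muxNodes c [(p, q)] : List (Node n)).flatMap encodeNode).reverse ++
          s newNodes))
        newOutputs ((encodeOutputs [c + 2]).reverse ++ s newOutputs) := by
  have outputs_eq : s outputs = .out :: (encodeUnary p ++ encodeOutputs L) := by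
    simpa [encodeOutputs] using h_outputs
  rw [encodeUnary, List.foldl_cons, List.foldl_append, foldl_muxLetter_ticks]
  funext j
  cases j <;>
    simp [muxLetter, outputs_eq, h_scratch, h_position, muxNodes, encodeNode, encodeUnary_eq,
      encodeOutputs, List.replicate_succ, ← List.replicate_succ']

theorem foldl_muxLetter {n : ℕ} (L : List (ℕ × ℕ)) (h_scratch : s scratch = [])
    (h_position : s position = ticks c) (h_outputs : s outputs = encodeOutputs (L.map Prod.fst)) :
    (encodeOutputs (L.map Prod.snd)).foldl (fun s a => (muxLetter a).exec s) s =
      update (update (update (update s outputs []) position (ticks (c + 3 * L.length)))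
        newNodes (((muxNodes c L : List (Node n)).flatMap encodeNode).reverse ++ s newNodes))
        newOutputs ((encodeOutputs (List.range' (c + 2) L.length 3)).reverse ++ s newOutputs) := by
  induction L generalizing s c with
  | nil =>
    funext j
    cases j <;> simp_all [encodeOutputs, muxNodes]
  | cons pq L ih =>
    obtain ⟨p, q⟩ := pq
    have fold_cons : encodeOutputs (((p, q) :: L).map Prod.snd) =
      (Letter.out :: encodeUnary q) ++ encodeOutputs (L.map Prod.snd) := by simp [encodeOutputs]
    rw [fold_cons, List.foldl_append,
      foldl_muxLetter_single (n := n) h_scratch h_position h_outputs,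
      ih (c := c + 3) (by simpa) (by simp) (by simp)]
    have position_eq : c + 3 + 3 * L.length = c + 3 * (L.length + 1) := by omega
    funext j
    cases j <;> simp [muxNodes, encodeOutputs, List.range'_succ, position_eq]

theorem loopTime_muxLetter_le {D : ℕ} (L : List Letter) (h_scratch : s scratch = [])
    (h_position : (s position).length + 3 * L.length ≤ D) (h_outputs : (s outputs).length ≤ D) :
    loopTime (fun s a => (muxLetter a).exec s) (fun a => (muxLetter a).time) L s ≤
      1 + L.length * (1 + (15 * D + 22)) := by
  refine loopTime_le (fun r s => s scratch = [] ∧ (s position).length + 3 * r ≤ D ∧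
    (s outputs).length ≤ D) ?_ ?_ L ⟨h_scratch, h_position, h_outputs⟩
  · rintro a s r ⟨h_scratch, h_position, h_outputs⟩
    have dropWhile_le := (List.dropWhile_suffix (l := (s outputs).tail) (· == .tick)).length_le
    simp only [List.length_tail] at dropWhile_le
    cases a <;> simp [muxLetter, h_scratch] <;> omega
  · rintro a s r ⟨h_scratch, h_position, h_outputs⟩
    have takeWhile_le := (List.takeWhile_prefix (l := (s outputs).tail) (· == .tick)).length_le
    simp only [List.length_tail] at takeWhile_le
    cases a <;> simp [muxLetter, h_scratch] <;> omega

end Multiplexers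

section Read

/-- The stacks while a pair of circuits is read: `N` and `O` are the nodes and the outputs of the
circuit with a selector, both in reverse, `d` is the position of its next node, `X` and `Y` are the
outputs of the pair, and `rest` is the unread input. -/
def reading (n d p : ℕ) (rest N O X Y : List Letter) : Stack → List Letter
  | input => rest
  | inputCount => ticks n
  | position => ticks d
  | posShift => ticks p
  | newNodes => N
  | newOutputs => O
  | outputs => X
  | saved => Y
  | output | param | remaining | nodes | scratch | varShift | offset | parity => []

/-- Consumes the number of inputs and writes the negated selector, the first node of
`CircuitPair.selector`. -/
def readInputCount : Program :=
  moveWhile (· == .tick) input inputCount ;; (pop input fun _ => skip) ;;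
  pushAll newNodes (encodeNode (.not 0 : Node 0)) ;; pushAll position (ticks 2)

/-- Consumes the parameter, which follows the pair in the input. -/
def readParam : Program :=
  moveWhile (· == .tick) input param ;; pop input fun _ => skip

/-- Consumes the encoding of a circuit and puts its outputs on `j`, with the number on `position`
added to all positions. -/
def readCircuit (j : Stack) : Program := readNodes ;; readOutputs j

/-- Writes the negated selector and the shifted nodes of both circuits, and puts their outputs on
`outputs` and `saved`. -/
def readPair : Program := readInputCount ;; readCircuit outputs ;; readCircuit saved

/-- Turns an encoded pair `P` and a parameter into the circuit `P.selector`. -/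
def read : Program := readPair ;; forAll saved muxLetter ;; readParam ;; commit

variable (P : CircuitPair) (n k d p : ℕ) (rest N O X : List Letter) {m : ℕ} (C : Circuit n m)

theorem exec_readInputCount :
    readInputCount.exec (single input (encodeUnary n ++ rest)) =
      reading n 2 0 rest (encodeNode (.not 0 : Node n)).reverse [] [] [] := by
  funext j
  cases j <;>
    simp [readInputCount, reading, encodeNode, single_of_ne, encodeUnary, List.replicate_succ]

theorem exec_readCircuit_outputs :
    (readCircuit outputs).exec (reading n d p (encodeCircuit C ++ rest) N [] [] []) =
      reading n (C.nodes.length + d) d rest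
        (((C.nodes.map (Node.shift 0 d le_rfl)).flatMap encodeNode).reverse ++ N) []
        (encodeOutputs ((List.ofFn C.outputs).map (· + d))) [] := by
  rw [readCircuit, exec, exec_readNodes (C := C) (d := d) (rest := rest) rfl rfl rfl rfl rfl,
    exec_readOutputs (d := d) (L := List.ofFn C.outputs) (rest := rest)] <;>
    first
    | (funext j; cases j <;> simp [reading])
    | simp [reading]

theorem exec_readCircuit_saved :
    (readCircuit saved).exec (reading n d p (encodeCircuit C ++ rest) N [] X []) =
      reading n (C.nodes.length + d) d rest
        (((C.nodes.map (Node.shift 0 d le_rfl)).flatMap encodeNode).reverse ++ N) []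
        X (encodeOutputs ((List.ofFn C.outputs).map (· + d))) := by
  rw [readCircuit, exec, exec_readNodes (C := C) (d := d) (rest := rest) rfl rfl rfl rfl rfl,
    exec_readOutputs (d := d) (L := List.ofFn C.outputs) (rest := rest)] <;>
    first
    | (funext j; cases j <;> simp [reading])
    | simp [reading]

theorem exec_mux (L : List (ℕ × ℕ)) : (forAll saved muxLetter).exec
    (reading n d p rest N [] (encodeOutputs (L.map Prod.fst)) (encodeOutputs (L.map Prod.snd))) =
      reading n (d + 3 * L.length) p rest
        (((muxNodes d L : List (Node n)).flatMap encodeNode).reverse ++ N)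
        (encodeOutputs (List.range' (d + 2) L.length 3)).reverse [] [] := by
  rw [exec_forAll]
  simp only [reading]
  rw [foldl_muxLetter (n := n) L rfl rfl rfl]
  funext j
  cases j <;> simp [reading]

theorem exec_readParam_commit {W : SelectorCircuit} (hW : W.n = n) :
    commit.exec (readParam.exec (reading n d p (encodeUnary k) (W.body.flatMap encodeNode).reverse
      (encodeOutputs (List.ofFn W.outs)).reverse [] [])) = store W k 0 := by
  funext j
  cases j <;> simp [readParam, commit, reading, store, encodeUnary, hW]

theorem map_fst_outputPairs :
    P.outputPairs.map Prod.fst = (List.ofFn P.X.outputs).map (· + 2) := by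
  simp [CircuitPair.outputPairs, List.map_ofFn, Function.comp_def]

theorem map_snd_outputPairs :
    P.outputPairs.map Prod.snd = (List.ofFn P.Y.outputs).map (· + (P.X.nodes.length + 2)) := by
  simp [CircuitPair.outputPairs, List.map_ofFn, Function.comp_def]

theorem encodePairParam_eq : encodePairParam (P, k) =
    encodeUnary P.n ++ (encodeCircuit P.X ++ (encodeCircuit P.Y ++ encodeUnary k)) := by
  simp [encodePairParam, encodePair]

theorem exec_readPair : readPair.exec (single input (encodePairParam (P, k))) =
    reading P.n (P.Y.nodes.length + (P.X.nodes.length + 2)) (P.X.nodes.length + 2) (encodeUnary k)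
      (encodeNode (.not 0 : Node P.n) ++
        ((P.X.nodes.map (Node.shift 0 2 le_rfl)).flatMap encodeNode ++
        (P.Y.nodes.map (Node.shift 0 (P.X.nodes.length + 2) le_rfl)).flatMap encodeNode)).reverse
      [] (encodeOutputs (P.outputPairs.map Prod.fst))
      (encodeOutputs (P.outputPairs.map Prod.snd)) := by
  simp only [readPair, exec]
  rw [encodePairParam_eq, exec_readInputCount, exec_readCircuit_outputs, exec_readCircuit_saved,
    map_fst_outputPairs, map_snd_outputPairs]
  simp only [List.reverse_append, List.append_assoc]

theorem exec_read : read.exec (single input (encodePairParam (P, k))) = store P.selector k 0 := by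
  simp only [read, exec]
  rw [exec_readPair, exec_mux]
  simpa only [P.flatMap_body_selector, P.ofFn_outs_selector, List.reverse_append,
    List.append_assoc] using exec_readParam_commit (W := P.selector) P.n k _ _ rfl

theorem time_readInputCount :
    readInputCount.time (single input (encodeUnary n ++ rest)) = 2 * n + 9 := by
  simp [readInputCount, encodeNode, encodeUnary]
  omega

theorem time_readCircuit_le {D : ℕ} (j : Stack) (hd : d ≤ D) (hp : p ≤ D) :
    (readCircuit j).time (reading n d p (encodeCircuit C ++ rest) N [] X []) ≤
      (encodeCircuit C).length * (7 * D + 6) + 9 * D + 9 := by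
  have time_nodes := time_readNodes_le (C := C) (rest := rest) (D := D)
    (s := reading n d p (encodeCircuit C ++ rest) N [] X [])
    ⟨rfl, by simp [reading], by simpa [reading] using hp, by simp [reading]⟩
    (by simpa [reading] using hd) rfl
  have time_outputs := time_readOutputs_le (D := D) (d := d) (j := j) (L := List.ofFn C.outputs)
    (s := readNodes.exec (reading n d p (encodeCircuit C ++ rest) N [] X [])) (rest := rest)
  rw [exec_readNodes (C := C) (d := d) (rest := rest) rfl rfl rfl rfl rfl] at time_outputs
  specialize time_outputs (by simpa [ShiftBounded, reading] using hd) rfl rfl rfl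
  have length_eq : (encodeCircuit C).length = (C.nodes.flatMap encodeNode).length +
      (encodeOutputs (List.ofFn C.outputs)).length + 1 := by simp [encodeCircuit_eq, add_assoc]
  rw [readCircuit, time, length_eq, Nat.add_mul, Nat.add_mul,
    exec_readNodes (C := C) (d := d) (rest := rest) rfl rfl rfl rfl rfl]
  omega

theorem time_mux_le {M : ℕ} (L : List (ℕ × ℕ)) (hM : 1 ≤ M) (hd : d ≤ M)
    (h_fst : (encodeOutputs (L.map Prod.fst)).length ≤ M ^ 2)
    (h_snd : (encodeOutputs (L.map Prod.snd)).length ≤ M ^ 2) :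
    (forAll saved muxLetter).time (reading n d p rest N [] (encodeOutputs (L.map Prod.fst))
      (encodeOutputs (L.map Prod.snd))) ≤ 84 * M ^ 4 := by
  rw [time_forAll]
  have M_le_sq : M ≤ M ^ 2 := Nat.le_self_pow two_ne_zero M
  have loop := loopTime_muxLetter_le (D := 4 * M ^ 2)
    (s := reading n d p rest N [] (encodeOutputs (L.map Prod.fst))
      (encodeOutputs (L.map Prod.snd))) (encodeOutputs (L.map Prod.snd)) rfl
    (by simp only [reading, List.length_replicate]; omega) (by simp only [reading]; omega)
  refine loop.trans ?_
  grw [h_snd]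
  nlinarith [Nat.pow_le_pow_right hM (show 2 ≤ 4 by norm_num), Nat.one_le_pow 4 M hM]

theorem time_readParam :
    readParam.time (reading n d p (encodeUnary k) N O [] []) = 2 * k + 3 := by
  have takeWhile_eq : (encodeUnary k).takeWhile (· == .tick) = ticks k := by
    rw [encodeUnary, List.takeWhile_append_of_pos] <;> simp
  simp [readParam, reading, takeWhile_eq]
  omega

theorem time_commit_readParam :
    commit.time (readParam.exec (reading n d p (encodeUnary k) N O [] [])) =
      7 + 2 * (N.length + O.length + d + p) := by
  simp [readParam, commit, reading]
  omega

theorem length_encodePairParam : (encodePairParam (P, k)).length =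
    P.n + (encodeCircuit P.X).length + (encodeCircuit P.Y).length + k + 2 := by
  simp [encodePairParam, encodePair, encodeUnary]
  omega

theorem time_readPair_le : readPair.time (single input (encodePairParam (P, k))) ≤
    60 * ((encodePairParam (P, k)).length + 1) ^ 2 := by
  set M := (encodePairParam (P, k)).length + 1 with hM
  have length_eq := length_encodePairParam P k
  have nodes_le : P.X.nodes.length ≤ (encodeCircuit P.X).length := by
    grw [encodeCircuit_eq, length_le_length_flatMap_encodeNode P.X.nodes]
    simp
  have time_X := time_readCircuit_le P.n 2 0 (encodeCircuit P.Y ++ encodeUnary k)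
    (encodeNode (.not 0 : Node P.n)).reverse [] P.X (D := M) outputs (by omega) (by omega)
  have time_Y := fun N X => time_readCircuit_le P.n (P.X.nodes.length + 2) 2 (encodeUnary k)
    N X P.Y (D := M) saved (by omega) (by omega)
  simp only [readPair, time]
  rw [encodePairParam_eq, exec_readInputCount, exec_readCircuit_outputs, time_readInputCount]
  grw [time_X, time_Y]
  nlinarith

theorem length_selector_body : P.selector.body.length =
    P.Y.nodes.length + P.X.nodes.length + 3 * P.m + 1 := by
  simp [CircuitPair.selector]
  omega

theorem length_encodeOutputs_outputPairs_le {M : ℕ} (hM : P.selector.size + 2 ≤ M) :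
    (encodeOutputs (P.outputPairs.map Prod.fst)).length ≤ M ^ 2 ∧
      (encodeOutputs (P.outputPairs.map Prod.snd)).length ≤ M ^ 2 := by
  have body_eq := length_selector_body P
  have m_eq : P.selector.m = P.m := rfl
  simp only [size] at hM
  have length_le {L : List ℕ} (h_length : L.length = P.m)
      (hL : ∀ p ∈ L, p < P.Y.nodes.length + (P.X.nodes.length + 2)) :
      (encodeOutputs L).length ≤ M ^ 2 :=
    calc _ ≤ L.length * (P.Y.nodes.length + (P.X.nodes.length + 2) + 1) :=
          length_encodeOutputs_le hL
      _ ≤ M * M := Nat.mul_le_mul (by omega) (by omega)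
      _ = M ^ 2 := (sq M).symm
  constructor <;> refine length_le (by simp) ?_ <;>
    simp only [List.mem_map, forall_exists_index, and_imp, forall_apply_eq_imp_iff₂]
  exacts [fun pq h => (P.outputPairs_lt pq h).1, fun pq h => (P.outputPairs_lt pq h).2]

theorem size_selector_add_le :
    P.selector.size + k + 2 ≤ (encodePairParam (P, k)).length + 1 := by
  have := P.size_selector_le
  simp only [encodePairParam, encodeUnary, List.length_append, List.length_replicate,
    List.length_cons, List.length_nil]
  omega

theorem time_read_le : read.time (single input (encodePairParam (P, k))) ≤
    200 * ((encodePairParam (P, k)).length + 1) ^ 4 := by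
  have size_le := size_selector_add_le P k
  have time_pair := time_readPair_le P k
  set M := (encodePairParam (P, k)).length + 1
  have ⟨fst_le, snd_le⟩ := length_encodeOutputs_outputPairs_le P (M := M) (by omega)
  have body_le : P.selector.body.length + 2 ≤ M := by simp only [size] at size_le; omega
  rw [length_selector_body] at body_le
  have time_mux := fun N => time_mux_le P.n (P.Y.nodes.length + (P.X.nodes.length + 2))
    (P.X.nodes.length + 2) (encodeUnary k) N P.outputPairs (by omega) (by omega) fst_le snd_le
  have nodes_le := P.selector.length_flatMap_body_le
  have outs_le := P.selector.length_encodeOutputs_outs_le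
  rw [P.flatMap_body_selector] at nodes_le
  rw [P.ofFn_outs_selector] at outs_le
  have size_sq_le : (P.selector.size + 1) ^ 2 ≤ M ^ 2 := Nat.pow_le_pow_left (by omega) 2
  have M_le_sq : M ≤ M ^ 2 := Nat.le_self_pow two_ne_zero M
  have sq_le_pow : M ^ 2 ≤ M ^ 4 := Nat.pow_le_pow_right (by omega) (by omega)
  simp only [read, time]
  rw [exec_readPair, exec_mux, time_readParam, time_commit_readParam]
  grw [time_pair, time_mux]
  simp only [P.length_outputPairs, List.length_append, List.length_reverse] at nodes_le outs_le ⊢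
  omega

end Read

end Program

namespace SelectorCircuit

open Function

/-- One round of amplification, the XOR construction followed by a direct product, as long as the
counter is positive. Since a round squares the error, the counter is halved. -/
def amplifyStep : SelectorCircuit × ℕ → SelectorCircuit × ℕ
  | (W, 0) => (W, 0)
  | (W, c + 1) => ((W.double true).double false, (c + 1) / 2)

/-- A bound, up to the factor `W.size + 8`, for the growth of `W` while `c` is counted down. -/
def growth (c : ℕ) : ℕ := max 1 (2 * c) ^ 2

theorem size_iterate_double_le (split : Bool) (W : SelectorCircuit) (n : ℕ) :
    ((double split)^[n] W).size + 8 ≤ 2 ^ n * (W.size + 8) := by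
  induction n with
  | zero => simp
  | succ n ih =>
    rw [iterate_succ_apply', pow_succ', mul_assoc]
    grw [size_double_le, ← ih]
    omega

theorem size_amplifyStep_le (W : SelectorCircuit) (c : ℕ) :
    ((amplifyStep (W, c)).1.size + 8) * growth (amplifyStep (W, c)).2 ≤
      (W.size + 8) * growth c := by
  cases c with
  | zero => rfl
  | succ c =>
    have size_le : ((W.double true).double false).size + 8 ≤ 4 * (W.size + 8) := by
      grw [size_double_le, size_double_le]
      omega
    have growth_le : 4 * growth ((c + 1) / 2) ≤ growth (c + 1) := by
      have half_le : 2 * max 1 (2 * ((c + 1) / 2)) ≤ max 1 (2 * (c + 1)) := by omega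
      simpa only [growth, mul_pow, Nat.reducePow] using Nat.pow_le_pow_left half_le 2
    calc _ ≤ 4 * (W.size + 8) * growth ((c + 1) / 2) := Nat.mul_le_mul_right _ size_le
      _ = (W.size + 8) * (4 * growth ((c + 1) / 2)) := by ring
      _ ≤ _ := Nat.mul_le_mul_left _ growth_le

theorem size_iterate_amplifyStep_le (W : SelectorCircuit) (c r : ℕ) :
    ((amplifyStep^[r] (W, c)).1.size + 8) * growth (amplifyStep^[r] (W, c)).2 ≤
      (W.size + 8) * growth c := by
  induction r with
  | zero => rfl
  | succ r ih =>
    rw [iterate_succ_apply']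
    exact (size_amplifyStep_le _ _).trans ih

theorem le_of_mul_growth_le {W : SelectorCircuit} {c B : ℕ} (hB : (W.size + 8) * growth c ≤ B) :
    W.size + 8 ≤ B ∧ c ≤ B := by
  have one_le_growth : 1 ≤ growth c := Nat.one_le_pow _ _ (by omega)
  have c_le_growth : c ≤ growth c :=
    (show c ≤ max 1 (2 * c) by omega).trans (Nat.le_self_pow two_ne_zero _)
  exact ⟨(Nat.le_mul_of_pos_right _ one_le_growth).trans hB,
    c_le_growth.trans ((Nat.le_mul_of_pos_left _ (by omega)).trans hB)⟩

end SelectorCircuit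

namespace CircuitPair

open SelectorCircuit

/-- The polarization of a pair of circuits: `h` applications of the XOR construction and `j` direct
products separate the two cases, and the rounds of amplification for the parameter `k` follow. -/
def polarize (h j : ℕ) (Pk : CircuitPair × ℕ) : CircuitPair :=
  (amplifyStep^[Pk.2]
    ((double false)^[j] ((double true)^[h] Pk.1.selector), Pk.2)).1.pair

end CircuitPair

namespace Program

open Function StackProgram Stack SelectorCircuit

variable (W : SelectorCircuit) (P : CircuitPair) (h i k c : ℕ)

/-- Puts every second letter on `saved`. -/
def halveLetter (a : Letter) : Program :=
  pop parity fun
    | none => push parity a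
    | some _ => push saved a

/-- Halves the number on `remaining`. -/
def halve : Program := forAll remaining halveLetter ;; clear parity ;; moveAll saved remaining

theorem foldl_halveLetter {s : Stack → List Letter} (h_parity : s parity = []) :
    (ticks c).foldl (fun s a => (halveLetter a).exec s) s =
      update (update s saved (ticks (c / 2) ++ s saved)) parity (ticks (c % 2)) := by
  induction c using Nat.twoStepInduction generalizing s with
  | zero =>
    funext j
    cases j <;> simp [h_parity]
  | one => simp [halveLetter, h_parity]
  | more c ih =>
    rw [ticks, List.replicate_succ, List.replicate_succ, List.foldl_cons, List.foldl_cons,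
      ih (by simp [halveLetter, h_parity])]
    funext j
    cases j <;> simp [halveLetter, h_parity, List.replicate_succ']

theorem store_param : store W k c param = ticks k := rfl

theorem store_remaining : store W k c remaining = ticks c := rfl

theorem exec_halve : halve.exec (store W k c) = store W k (c / 2) := by
  rw [halve, exec, exec_forAll, store_remaining,
    foldl_halveLetter c rfl]
  funext j
  cases j <;> simp [store]

theorem time_halve_le : halve.time (store W k c) ≤ 4 * c + 5 := by
  have time_letter (a : Letter) (s : Stack → List Letter) : (halveLetter a).time s = 2 := by
    cases h_head : (s parity).head? <;> simp [halveLetter, h_head]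
  rw [halve, time, time, time_forAll, exec_forAll, store_remaining,
    foldl_halveLetter c rfl, loopTime_of_const time_letter]
  simp [store]
  omega

/-- The program for `SelectorCircuit.amplifyStep`. -/
def amplifyStep : Program :=
  pop remaining fun
    | none => skip
    | some a => push remaining a ;; double true ;; double false ;; halve

theorem restore_remaining : update (update (store W k (c + 1)) remaining (ticks c)) remaining
    (.tick :: ticks c) = store W k (c + 1) := by
  funext j
  cases j <;> simp [store, List.replicate_succ]

theorem exec_amplifyStep : amplifyStep.exec (store W k c) =
    store (SelectorCircuit.amplifyStep (W, c)).1 k (SelectorCircuit.amplifyStep (W, c)).2 := by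
  cases c with
  | zero =>
    funext j
    cases j <;> simp [amplifyStep, SelectorCircuit.amplifyStep, store]
  | succ c =>
    simp only [amplifyStep, exec, store_remaining, List.replicate_succ, List.head?_cons,
      List.tail_cons, update_self, restore_remaining, exec_double, exec_halve,
      SelectorCircuit.amplifyStep]

theorem time_amplifyStep_le {B : ℕ} (hB : (W.size + 8) * growth c ≤ B) :
    amplifyStep.time (store W k c) ≤ 23000 * B ^ 3 := by
  have ⟨size_le, c_le⟩ := le_of_mul_growth_le hB
  have B_le_cube : B ≤ B ^ 3 := Nat.le_self_pow three_ne_zero B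
  cases c with
  | zero =>
    simp only [amplifyStep, time, store, List.replicate_zero, List.head?_nil]
    omega
  | succ c =>
    have first_le : (W.size + 1) ^ 3 ≤ B ^ 3 := Nat.pow_le_pow_left (by omega) 3
    have second_le : ((W.double true).size + 1) ^ 3 ≤ 8 * B ^ 3 :=
      (Nat.pow_le_pow_left (by grw [size_double_le]; omega) 3).trans_eq (mul_pow 2 B 3)
    simp only [amplifyStep, time, exec, store_remaining, List.replicate_succ, List.head?_cons,
      List.tail_cons, update_self, restore_remaining, exec_double]
    grw [time_double_le, time_double_le, time_halve_le, first_le, second_le]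
    omega

theorem foldl_amplifyStep (r : ℕ) :
    (ticks r).foldl (fun s _ => amplifyStep.exec s) (store W k c) =
      store (SelectorCircuit.amplifyStep^[r] (W, c)).1 k
        (SelectorCircuit.amplifyStep^[r] (W, c)).2 := by
  induction r generalizing W c with
  | zero => rfl
  | succ r ih =>
    rw [ticks, List.replicate_succ, List.foldl_cons, exec_amplifyStep, ih, iterate_succ_apply]

/-- The rounds of amplification, with the parameter on `param` as the initial value of the
counter. -/
def amplify : Program := copy scratch param remaining ;; forAll param fun _ => amplifyStep

theorem exec_copy_param :
    (copy scratch param remaining).exec (store W k 0) = store W k k := by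
  rw [exec_copy _ rfl (by decide) (by decide) (by decide)]
  funext j
  cases j <;> simp [store]

theorem exec_amplify : amplify.exec (store W k 0) =
    store (SelectorCircuit.amplifyStep^[k] (W, k)).1 0
      (SelectorCircuit.amplifyStep^[k] (W, k)).2 := by
  rw [amplify, exec, exec_copy_param, exec_forAll, store_param, foldl_amplifyStep]
  funext j
  cases j <;> rfl

theorem time_amplify_le {B : ℕ} (hB : (W.size + 8) * growth k ≤ B) :
    amplify.time (store W k 0) ≤ 3 + 6 * k + k * (23000 * B ^ 3) := by
  have copy_le : (copy scratch param remaining).time (store W k 0) = 2 + 5 * k := by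
    rw [time_copy _ rfl (by decide)]
    simp [store, mul_comm]
  have loop_le := loopTime_le (f := fun s (_ : Letter) => amplifyStep.exec s)
    (t := fun _ => amplifyStep.time) (c := 23000 * B ^ 3)
    (fun _ s => ∃ W c, s = store W k c ∧ (W.size + 8) * growth c ≤ B)
    (by
      rintro _ _ _ ⟨W, c, rfl, h_size⟩
      exact ⟨_, _, exec_amplifyStep W k c, (size_amplifyStep_le W c).trans h_size⟩)
    (by
      rintro _ _ _ ⟨W, c, rfl, h_size⟩
      exact time_amplifyStep_le W k c h_size)
    (ticks k) ⟨W, k, rfl, hB⟩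
  rw [amplify, time, copy_le, exec_copy_param, time_forAll, store_param]
  grw [loop_le]
  rw [List.length_replicate, mul_add, mul_one]
  omega

/-- Writes the encoding of the pair that a circuit with a selector represents. -/
def write : Program :=
  push output .fin ;; copy scratch outputs output ;; copy scratch nodes output ;; push output .tt ;;
  push output .fin ;; copy scratch outputs output ;; copy scratch nodes output ;; push output .ff ;;
  push output .comma ;; moveAll inputCount output ;; clear outputs ;; clear nodes ;; clear remaining

theorem exec_write : write.exec (store W 0 c) = single output (encodePair W.pair) := by
  funext j
  cases j <;> simp [write, store, single_of_ne, encodePair, encodeCircuit_eq, pair, circuit,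
    encodeNode, encodeUnary]

theorem time_write : write.time (store W k c) = 17 + 12 * (W.body.flatMap encodeNode).length +
    12 * (encodeOutputs (List.ofFn W.outs)).length + 2 * W.n + 2 * c := by
  simp [write, store]
  omega

/-- The program for `CircuitPair.polarize`. -/
def polarize : Program :=
  read ;; iterate (double true) h ;; iterate (double false) i ;; amplify ;; write

theorem exec_iterate_double (split : Bool) (n : ℕ) : (iterate (double split) n).exec (store W k c) =
    store ((SelectorCircuit.double split)^[n] W) k c := by
  induction n generalizing W with
  | zero => rfl
  | succ n ih => rw [iterate, exec, exec_double, ih, iterate_succ_apply]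

theorem exec_polarize : (polarize h i).exec (single input (encodePairParam (P, k))) =
    single output (encodePair (CircuitPair.polarize h i (P, k))) := by
  simp only [polarize, exec]
  rw [exec_read, exec_iterate_double, exec_iterate_double, exec_amplify, exec_write]
  rfl

theorem time_iterate_double_le (split : Bool) (n : ℕ) {B : ℕ} (hB : 2 ^ n * (W.size + 8) ≤ B) :
    (iterate (double split) n).time (store W k c) ≤ 1 + n * (2500 * B ^ 3) := by
  induction n generalizing W with
  | zero => simp [iterate]
  | succ n ih =>
    have size_le : W.size + 1 ≤ B :=
      (show W.size + 1 ≤ W.size + 8 by omega).trans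
        ((Nat.le_mul_of_pos_left _ (by positivity)).trans hB)
    have double_le : 2 ^ n * ((W.double split).size + 8) ≤ B := by
      grw [size_double_le, ← hB, pow_succ, mul_assoc]
      exact Nat.mul_le_mul_left _ (by omega)
    rw [iterate, time, exec_double, Nat.add_mul]
    grw [time_double_le, ih _ double_le, size_le]
    omega

theorem time_write_le {B : ℕ} (hB : (W.size + 8) * growth c ≤ B) :
    write.time (store W k c) ≤ 105 * B ^ 3 := by
  have ⟨size_le, c_le⟩ := le_of_mul_growth_le hB
  have size_sq_le : (W.size + 1) ^ 2 ≤ B ^ 2 := Nat.pow_le_pow_left (by omega) 2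
  have n_le : W.n ≤ W.size := by simp only [size]; omega
  have B_le_cube : B ≤ B ^ 3 := Nat.le_self_pow three_ne_zero B
  have sq_le_cube : B ^ 2 ≤ B ^ 3 := Nat.pow_le_pow_right (by omega) (by omega)
  rw [time_write]
  grw [W.length_flatMap_body_le, W.length_encodeOutputs_outs_le]
  omega

/-- A bound for the circuits that `CircuitPair.polarize` constructs from an input of length less
than `M`. -/
def sizeBound (h i M : ℕ) : ℕ := 28 * 2 ^ (h + i) * M ^ 3

theorem mul_growth_le_sizeBound {M : ℕ} (hM : P.selector.size + k + 2 ≤ M) :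
    2 ^ h * (P.selector.size + 8) ≤ sizeBound h i M ∧
    2 ^ i * (((SelectorCircuit.double true)^[h] P.selector).size + 8) ≤ sizeBound h i M ∧
    (((SelectorCircuit.double false)^[i]
      ((SelectorCircuit.double true)^[h] P.selector)).size + 8) * growth k ≤ sizeBound h i M := by
  have size_le : P.selector.size + 8 ≤ 7 * M := by omega
  have growth_le : growth k ≤ (2 * M) ^ 2 := Nat.pow_le_pow_left (by omega) 2
  have sizeBound_eq : 2 ^ (h + i) * (7 * M) * (2 * M) ^ 2 = sizeBound h i M := by
    rw [sizeBound]
    ring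
  have le_sizeBound : 2 ^ (h + i) * (7 * M) ≤ sizeBound h i M :=
    sizeBound_eq ▸ Nat.le_mul_of_pos_right _ (pow_pos (by omega) 2)
  have doubled_le : 2 ^ i * (((SelectorCircuit.double true)^[h] P.selector).size + 8) ≤
      2 ^ (h + i) * (7 * M) := by
    grw [size_iterate_double_le, size_le, pow_add]
    exact (by ring : 2 ^ i * (2 ^ h * (7 * M)) = 2 ^ h * 2 ^ i * (7 * M)).le
  refine ⟨?_, doubled_le.trans le_sizeBound, ?_⟩
  · grw [size_le, ← le_sizeBound, Nat.le_add_right h i]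
    norm_num
  · grw [size_iterate_double_le, doubled_le, growth_le, sizeBound_eq]

theorem time_polarize_le : (polarize h i).time (single input (encodePairParam (P, k))) ≤
    24000 * (h + i + 1) * ((encodePairParam (P, k)).length + 1) *
      sizeBound h i ((encodePairParam (P, k)).length + 1) ^ 3 := by
  have size_le := size_selector_add_le P k
  have read_le := time_read_le P k
  have k_le : k ≤ (encodePairParam (P, k)).length + 1 := by omega
  set M := (encodePairParam (P, k)).length + 1
  have ⟨xor_le, direct_le, growth_le⟩ := mul_growth_le_sizeBound P h i k size_le
  set B := sizeBound h i M
  have M_le_B : M ≤ B :=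
    (Nat.le_self_pow three_ne_zero M).trans (Nat.le_mul_of_pos_left _ (by positivity))
  have pow_le : M ^ 4 ≤ M * B ^ 3 :=
    (pow_succ' M 3).trans_le (Nat.mul_le_mul_left M (Nat.pow_le_pow_left M_le_B 3))
  have cube_pos : 1 ≤ B ^ 3 := Nat.one_le_pow _ _ (by omega)
  have cube_le : B ^ 3 ≤ M * B ^ 3 := Nat.le_mul_of_pos_left _ (by omega)
  have write_le : write.time _ ≤ _ :=
    time_write_le _ 0 _ ((size_iterate_amplifyStep_le _ k k).trans growth_le)
  simp only [polarize, time]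
  rw [exec_read, exec_iterate_double, exec_iterate_double, exec_amplify]
  grw [read_le, time_iterate_double_le _ _ _ _ _ xor_le, time_iterate_double_le _ _ _ _ _ direct_le,
    time_amplify_le _ _ growth_le, write_le, pow_le]
  nlinarith

theorem wellFormed_double (split : Bool) : (double split).WellFormed := by
  have letter (a : Letter) : (shiftNodeLetter a).Avoids saved ∧ (shiftNodeLetter a).WellFormed ∧
      (shiftOutputLetter a).Avoids saved ∧ (shiftOutputLetter a).WellFormed := by
    cases a <;> simp [shiftNodeLetter, shiftOutputLetter]
  simp [double, header, copyPass, commit, shiftNodes, shiftOutputs, letter]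

theorem wellFormed_read : read.WellFormed := by
  have letter (a : Letter) : (shiftNodeLetter a).Avoids input ∧ (shiftNodeLetter a).WellFormed ∧
      (shiftOutputLetter a).Avoids input ∧ (shiftOutputLetter a).WellFormed ∧
      (muxLetter a).Avoids saved ∧ (muxLetter a).WellFormed := by
    cases a <;> simp [shiftNodeLetter, shiftOutputLetter, muxLetter]
  simp [read, readPair, readInputCount, readCircuit, readNodes, readOutputs, readParam, commit,
    letter]

theorem avoids_double (split : Bool) : (double split).Avoids param := by
  have letter (a : Letter) : (shiftNodeLetter a).Avoids param ∧
      (shiftOutputLetter a).Avoids param := by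
    cases a <;> simp [shiftNodeLetter, shiftOutputLetter]
  simp [double, header, copyPass, commit, shiftNodes, shiftOutputs, letter]

theorem avoids_halveLetter {x : Stack} (h_parity : parity ≠ x) (h_saved : saved ≠ x) (a : Letter) :
    (halveLetter a).Avoids x := by
  refine ⟨h_parity, ?_⟩
  rintro (_ | _)
  exacts [h_parity, h_saved]

theorem wellFormed_halveLetter (a : Letter) : (halveLetter a).WellFormed := by
  rintro (_ | _) <;> trivial

theorem wellFormed_amplify : amplify.WellFormed := by
  have halve_avoids : halve.Avoids param := by simp [halve, avoids_halveLetter]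
  have halve_wellFormed : halve.WellFormed := by
    simp [halve, avoids_halveLetter, wellFormed_halveLetter]
  refine ⟨wellFormed_copy (by decide) (by decide), fun _ => ⟨⟨by decide, ?_⟩, ?_⟩⟩ <;>
    rintro (_ | _) <;> simp [avoids_double, wellFormed_double, halve_avoids, halve_wellFormed]

theorem wellFormed_write : write.WellFormed := by
  simp [write]

theorem wellFormed_polarize : (polarize h i).WellFormed :=
  ⟨wellFormed_read, (wellFormed_double true).iterate h, (wellFormed_double false).iterate i,
    wellFormed_amplify, wellFormed_write⟩

/-- Appends the encoding of `k` to the input. -/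
def appendParam (k : ℕ) : Program :=
  moveAll input saved ;; pushAll input (encodeUnary k).reverse ;; moveAll saved input

theorem exec_appendParam : (appendParam k).exec (single input (encodePair P)) =
    single input (encodePairParam (P, k)) := by
  funext j
  cases j <;> simp [appendParam, encodePairParam, single_of_ne]

theorem time_appendParam : (appendParam k).time (single input (encodePair P)) =
    4 * (encodePair P).length + k + 4 := by
  simp [appendParam, single_of_ne, encodeUnary]
  omega

theorem wellFormed_appendParam : (appendParam k).WellFormed := by simp [appendParam]

/-- The bound of `time_polarize_le` as a polynomial in the length of the input. -/
noncomputable def timeBound (h i : ℕ) : Polynomial ℕ :=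
  .C (24000 * (h + i + 1)) * (.X + 1) * (.C (28 * 2 ^ (h + i)) * (.X + 1) ^ 3) ^ 3

theorem eval_timeBound (n : ℕ) : (timeBound h i).eval n =
    24000 * (h + i + 1) * (n + 1) * sizeBound h i (n + 1) ^ 3 := by
  simp [timeBound, sizeBound]

theorem polyTime_polarize :
    PolyTime encodePairParam encodePair (CircuitPair.polarize h i) :=
  polyTime_of_exec (wellFormed_polarize h i) (fun Pk => exec_polarize Pk.1 h i Pk.2)
    (T := timeBound h i)
    fun Pk => (time_polarize_le Pk.1 h i Pk.2).trans_eq (eval_timeBound ..).symm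

theorem polyTime_polarize_const :
    PolyTime encodePair encodePair fun P => CircuitPair.polarize h i (P, k) := by
  refine polyTime_of_exec (p := appendParam k ;; polarize h i) (input := input) (output := output)
    ⟨wellFormed_appendParam k, wellFormed_polarize h i⟩
    (T := .C 4 * .X + .C (k + 4) + (timeBound h i).comp (.X + .C (k + 1))) ?_ ?_
  · intro P
    rw [exec, exec_appendParam, exec_polarize]
  · intro P
    have length_eq : (encodePairParam (P, k)).length = (encodePair P).length + (k + 1) := by
      simp [encodePairParam, encodeUnary]
    rw [time, time_appendParam, exec_appendParam]
    grw [time_polarize_le]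
    simp [eval_timeBound, length_eq, add_assoc]

end Program

section UniformProbability

open scoped BigOperators
open Set (range)

variable {Ω Ω' ι ι' α β : Type*} [Fintype Ω] [Fintype Ω']

open Classical in
/-- The probability of an event under the uniform distribution on a finite type. -/
noncomputable def uniformProb (p : Ω → Prop) : ℝ := 𝔼 x, if p x then 1 else 0

theorem uniformProb_eq_card_div (p : Ω → Prop) [DecidablePred p] :
    uniformProb p = (Finset.univ.filter p).card / Fintype.card Ω := by
  rw [uniformProb, Fintype.expect_eq_sum_div_card, ← Finset.sum_boole]
  congr!

theorem uniformProb_nonneg (p : Ω → Prop) : 0 ≤ uniformProb p := by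
  classical
  rw [uniformProb_eq_card_div]
  positivity

theorem uniformProb_mono {p q : Ω → Prop} (h : ∀ x, p x → q x) : uniformProb p ≤ uniformProb q := by
  classical
  simp only [uniformProb_eq_card_div]
  gcongr
  exact h _

theorem uniformProb_not [Nonempty Ω] (p : Ω → Prop) :
    uniformProb (fun x => ¬ p x) = 1 - uniformProb p := by
  rw [eq_sub_iff_add_eq, uniformProb, uniformProb, ← Finset.expect_add_distrib]
  refine (Finset.expect_congr rfl fun x _ => ?_).trans (Fintype.expect_const (ι := Ω) 1)
  by_cases h : p x <;> simp [h]

theorem uniformProb_comp_equiv (e : Ω' ≃ Ω) (p : Ω → Prop) :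
    uniformProb (fun x => p (e x)) = uniformProb p :=
  Fintype.expect_equiv e _ _ fun _ => rfl

theorem uniformProb_prod (p : Ω → Prop) (q : Ω' → Prop) :
    uniformProb (fun z : Ω × Ω' => p z.1 ∧ q z.2) = uniformProb p * uniformProb q := by
  simp only [uniformProb, ← Finset.univ_product_univ, Finset.expect_product,
    Fintype.expect_mul_expect, ite_zero_mul_ite_zero, one_mul]
  congr!

theorem uniformProb_bool_prod (p : Bool × Ω → Prop) : uniformProb p =
    (uniformProb (fun x => p (false, x)) + uniformProb (fun x => p (true, x))) / 2 := by
  simp only [uniformProb, ← Finset.univ_product_univ, Finset.expect_product]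
  rw [Fintype.expect_eq_sum_div_card, Fintype.sum_bool, add_comm, Fintype.card_bool, Nat.cast_two]

/-- The distribution of a random variable `F` on a finite probability space with the uniform
distribution: the probability of the value `y`. -/
noncomputable def law (F : Ω → α) (y : α) : ℝ := uniformProb fun x => F x = y

theorem law_nonneg (F : Ω → α) (y : α) : 0 ≤ law F y := uniformProb_nonneg _

theorem sum_law [Nonempty Ω] [Fintype α] (F : Ω → α) : ∑ y, law F y = 1 := by
  classical
  simp only [law, uniformProb, ← Finset.expect_sum_comm, Finset.sum_ite_eq, Finset.mem_univ,
    if_true, Fintype.expect_one]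

/-- The statistical difference of the distributions of two random variables. -/
noncomputable def statDiff [Fintype α] (F : Ω → α) (G : Ω' → α) : ℝ :=
  1 / 2 * ∑ y, |law F y - law G y|

theorem statDiff_nonneg [Fintype α] (F : Ω → α) (G : Ω' → α) : 0 ≤ statDiff F G := by
  unfold statDiff
  positivity

theorem statDiff_le_one [Nonempty Ω] [Nonempty Ω'] [Fintype α] (F : Ω → α) (G : Ω' → α) :
    statDiff F G ≤ 1 := by
  have sum_le : ∑ y, |law F y - law G y| ≤ ∑ y, (law F y + law G y) :=
    Finset.sum_le_sum fun y _ => abs_sub_le_of_nonneg_of_le (law_nonneg F y)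
      (le_add_of_nonneg_right (law_nonneg G y)) (law_nonneg G y)
      (le_add_of_nonneg_left (law_nonneg F y))
  rw [Finset.sum_add_distrib, sum_law, sum_law] at sum_le
  unfold statDiff
  linarith

/-- The probability that `F` takes a value outside of the range of `G`. -/
noncomputable def disjointness (F : Ω → α) (G : ι → α) : ℝ := uniformProb fun x => F x ∉ range G

section Relabelling

variable (e : Ω' ≃ Ω) (e' : β ≃ α) {F G : Ω → α} {F' G' : Ω' → β}

theorem law_eq_of_equiv (hF : ∀ x, F (e x) = e' (F' x)) (z : β) : law F (e' z) = law F' z := by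
  rw [law, ← uniformProb_comp_equiv e]
  simp only [hF, e'.apply_eq_iff_eq, law]

theorem statDiff_eq_of_equiv [Fintype α] [Fintype β] (hF : ∀ x, F (e x) = e' (F' x))
    (hG : ∀ x, G (e x) = e' (G' x)) : statDiff F G = statDiff F' G' := by
  simp only [statDiff, ← e'.sum_comp, law_eq_of_equiv e e' hF, law_eq_of_equiv e e' hG]

theorem disjointness_eq_of_equiv (hF : ∀ x, F (e x) = e' (F' x))
    (hG : ∀ x, G (e x) = e' (G' x)) : disjointness F G = disjointness F' G' := by
  rw [disjointness, ← uniformProb_comp_equiv e]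
  simp only [disjointness, Set.mem_range, ← e.exists_congr_right, hF, hG, e'.apply_eq_iff_eq]

end Relabelling

theorem statDiff_comp_snd [Fintype α] (F G : Ω → α) :
    statDiff (fun z : Bool × Ω => F z.2) (fun z : Bool × Ω => G z.2) = statDiff F G := by
  simp only [statDiff, law, uniformProb_bool_prod, add_self_div_two]

theorem disjointness_comp_snd (F G : Ω → α) :
    disjointness (fun z : Bool × Ω => F z.2) (fun z : Bool × Ω => G z.2) = disjointness F G := by
  have range_eq : range (fun z : Bool × Ω => G z.2) = range G :=
    Prod.snd_surjective.range_comp G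
  simp only [disjointness, range_eq, uniformProb_bool_prod, add_self_div_two]

theorem one_sub_disjointness [Nonempty Ω] (F : Ω → α) (G : ι → α) :
    1 - disjointness F G = uniformProb fun x => F x ∈ range G := by
  rw [disjointness, uniformProb_not, sub_sub_cancel]

section Products

variable {F G : Ω → α} {F' G' : Ω' → β}

theorem law_prodMap (F : Ω → α) (F' : Ω' → β) (y : α) (z : β) :
    law (Prod.map F F') (y, z) = law F y * law F' z := by
  simp only [law, ← uniformProb_prod, Prod.map_apply', Prod.mk.injEq]

theorem statDiff_prodMap_le [Nonempty Ω] [Nonempty Ω'] [Fintype α] [Fintype β] :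
    statDiff (Prod.map F F') (Prod.map G G') ≤ statDiff F G + statDiff F' G' := by
  have abs_le (y : α) (z : β) : |law F y * law F' z - law G y * law G' z| ≤
      law F y * |law F' z - law G' z| + |law F y - law G y| * law G' z :=
    calc _ = |law F y * (law F' z - law G' z) + (law F y - law G y) * law G' z| := by ring_nf
      _ ≤ |law F y * (law F' z - law G' z)| + |(law F y - law G y) * law G' z| := abs_add_le _ _
      _ = _ := by
        rw [abs_mul, abs_mul, abs_of_nonneg (law_nonneg F y), abs_of_nonneg (law_nonneg G' z)]
  have sum_abs_le := Finset.sum_le_sum fun y (_ : y ∈ Finset.univ) =>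
    Finset.sum_le_sum fun z (_ : z ∈ Finset.univ) => abs_le y z
  simp only [Finset.sum_add_distrib, ← Finset.mul_sum, ← Finset.sum_mul, sum_law, one_mul,
    mul_one] at sum_abs_le
  simp only [statDiff, Fintype.sum_prod_type, law_prodMap]
  linarith

theorem one_sub_disjointness_prodMap [Nonempty Ω] [Nonempty Ω'] (F : Ω → α) (G : ι → α)
    (F' : Ω' → β) (G' : ι' → β) :
    1 - disjointness (Prod.map F F') (Prod.map G G') =
      (1 - disjointness F G) * (1 - disjointness F' G') := by
  simp only [one_sub_disjointness, ← uniformProb_prod, Set.range_prodMap, Set.mem_prod,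
    Prod.map_fst, Prod.map_snd]

end Products

section Xor

variable {F : Bool → Ω → α} {F' : Bool → Ω' → β}

/-- The XOR construction: independent samples of the families `F` and `F'` for random indices whose
exclusive or is `c`. -/
def xorProd (F : Bool → Ω → α) (F' : Bool → Ω' → β) (c : Bool) (z : Bool × Ω × Ω') : α × β :=
  (F z.1 z.2.1, F' (xor c z.1) z.2.2)

theorem law_xorProd (c : Bool) (y : α) (z : β) : law (xorProd F F' c) (y, z) =
    (law (F false) y * law (F' c) z + law (F true) y * law (F' !c) z) / 2 := by
  simp only [law, xorProd, uniformProb_bool_prod, ← uniformProb_prod, Prod.mk.injEq,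
    Bool.xor_false, Bool.xor_true]

theorem statDiff_xorProd [Fintype α] [Fintype β] :
    statDiff (xorProd F F' false) (xorProd F F' true) =
      statDiff (F false) (F true) * statDiff (F' false) (F' true) := by
  have abs_eq (y : α) (z : β) :
      |law (xorProd F F' false) (y, z) - law (xorProd F F' true) (y, z)| =
        1 / 2 * (|law (F false) y - law (F true) y| * |law (F' false) z - law (F' true) z|) := by
    rw [law_xorProd, law_xorProd, ← abs_mul, ← abs_of_pos (one_half_pos (α := ℝ)), ← abs_mul,
      Bool.not_false, Bool.not_true]
    ring_nf
  simp only [statDiff, Fintype.sum_prod_type, abs_eq, ← Finset.mul_sum, ← Finset.sum_mul]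
  ring

theorem le_disjointness_xorProd (c : Bool) :
    (disjointness (F false) (F true) * disjointness (F' c) (F' !c) +
      disjointness (F true) (F false) * disjointness (F' !c) (F' c)) / 2 ≤
    disjointness (xorProd F F' c) (xorProd F F' !c) := by
  have not_mem_range (t : Bool) (r : Ω) (r' : Ω') (h : F t r ∉ range (F !t))
      (h' : F' (xor c t) r' ∉ range (F' !(xor c t))) :
      xorProd F F' c (t, r, r') ∉ range (xorProd F F' !c) := by
    rintro ⟨⟨t', s, s'⟩, eq⟩
    obtain ⟨eq_left, eq_right⟩ := Prod.mk.inj eq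
    obtain rfl | rfl : t' = t ∨ t' = !t := by cases t <;> cases t' <;> simp
    · exact h' ⟨s', by simpa only [Bool.not_xor] using eq_right⟩
    · exact h ⟨s, eq_left⟩
  have prod_le (t : Bool) : disjointness (F t) (F !t) *
      disjointness (F' (xor c t)) (F' !(xor c t)) ≤
        uniformProb fun x => xorProd F F' c (t, x) ∉ range (xorProd F F' !c) := by
    rw [disjointness, disjointness, ← uniformProb_prod]
    exact uniformProb_mono fun x h => not_mem_range t x.1 x.2 h.1 h.2
  rw [disjointness.eq_1 (xorProd F F' c), uniformProb_bool_prod]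
  have le_false := prod_le false
  have le_true := prod_le true
  simp only [Bool.xor_false, Bool.xor_true, Bool.not_false, Bool.not_true, Bool.not_not]
    at le_false le_true
  gcongr

end Xor

end UniformProbability

section CircuitDistribution

variable {n m : ℕ} (X Y : Circuit n m)

theorem card_boolVector (n : ℕ) : (Fintype.card (Fin n → Bool) : ℝ) = 2 ^ n := by simp

theorem SD_eq_statDiff : SD X Y = statDiff X.eval Y.eval := by
  simp only [SD, statDiff, Circuit.prob, law, uniformProb_eq_card_div, card_boolVector]

theorem Disj_eq_disjointness : Disj X Y = disjointness X.eval Y.eval := by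
  simp only [Disj, disjointness, uniformProb_eq_card_div, card_boolVector, Set.mem_range,
    not_exists, ne_eq, eq_comm]

theorem SD_nonneg : 0 ≤ SD X Y := SD_eq_statDiff X Y ▸ statDiff_nonneg _ _

theorem SD_le_one : SD X Y ≤ 1 := SD_eq_statDiff X Y ▸ statDiff_le_one _ _

theorem SD_self : SD X X = 0 := by simp [SD]

theorem Disj_nonneg : 0 ≤ Disj X Y := by
  unfold Disj
  positivity

theorem mutDisj_nonneg : 0 ≤ mutDisj X Y := le_min (Disj_nonneg X Y) (Disj_nonneg Y X)

theorem Disj_le_one : Disj X Y ≤ 1 := (Disj_le_SD X Y).trans (SD_le_one X Y)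

theorem mutDisj_le_one : mutDisj X Y ≤ 1 :=
  (min_le_left _ _).trans (Disj_le_one X Y)

end CircuitDistribution

namespace SelectorCircuit

variable (W : SelectorCircuit)

/-- The statistical difference of the pair of circuits that `W` represents. -/
noncomputable def sd : ℝ := SD (W.circuit false) (W.circuit true)

/-- The mutual disjointness of the pair of circuits that `W` represents. -/
noncomputable def disj : ℝ := mutDisj (W.circuit false) (W.circuit true)

/-- The inputs of `double split W` as a fresh random bit and an input for each copy of `W`. -/
def inputEquiv (n : ℕ) : Bool × (Fin n → Bool) × (Fin n → Bool) ≃ (Fin (n + n + 1) → Bool) :=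
  ((Equiv.refl Bool).prodCongr (Fin.appendEquiv n n)).trans (Fin.consEquiv fun _ => Bool)

theorem eval_double_true (c : Bool) (z : Bool × (Fin W.n → Bool) × (Fin W.n → Bool)) :
    ((W.double true).circuit c).eval (inputEquiv W.n z) = Fin.appendEquiv W.m W.m
      (xorProd (fun c => (W.circuit c).eval) (fun c => (W.circuit c).eval) c z) :=
  W.eval_double true c z.1 z.2.1 z.2.2

theorem eval_double_false (c : Bool) (z : Bool × (Fin W.n → Bool) × (Fin W.n → Bool)) :
    ((W.double false).circuit c).eval (inputEquiv W.n z) =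
      Fin.appendEquiv W.m W.m (Prod.map (W.circuit c).eval (W.circuit c).eval z.2) :=
  W.eval_double false c z.1 z.2.1 z.2.2

theorem SD_double_true (c d : Bool) :
    SD ((W.double true).circuit c) ((W.double true).circuit d) =
      statDiff (xorProd (fun c => (W.circuit c).eval) (fun c => (W.circuit c).eval) c)
        (xorProd (fun c => (W.circuit c).eval) (fun c => (W.circuit c).eval) d) :=
  (SD_eq_statDiff _ _).trans
    (statDiff_eq_of_equiv _ _ (W.eval_double_true c) (W.eval_double_true d))

theorem SD_double_false (c d : Bool) :
    SD ((W.double false).circuit c) ((W.double false).circuit d) =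
      statDiff (Prod.map (W.circuit c).eval (W.circuit c).eval)
        (Prod.map (W.circuit d).eval (W.circuit d).eval) :=
  (SD_eq_statDiff _ _).trans <|
    (statDiff_eq_of_equiv _ _ (W.eval_double_false c) (W.eval_double_false d)).trans
      (statDiff_comp_snd _ _)

theorem Disj_double_true (c d : Bool) :
    Disj ((W.double true).circuit c) ((W.double true).circuit d) =
      disjointness (xorProd (fun c => (W.circuit c).eval) (fun c => (W.circuit c).eval) c)
        (xorProd (fun c => (W.circuit c).eval) (fun c => (W.circuit c).eval) d) :=
  (Disj_eq_disjointness _ _).trans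
    (disjointness_eq_of_equiv _ _ (W.eval_double_true c) (W.eval_double_true d))

theorem Disj_double_false (c d : Bool) :
    Disj ((W.double false).circuit c) ((W.double false).circuit d) =
      disjointness (Prod.map (W.circuit c).eval (W.circuit c).eval)
        (Prod.map (W.circuit d).eval (W.circuit d).eval) :=
  (Disj_eq_disjointness _ _).trans <|
    (disjointness_eq_of_equiv _ _ (W.eval_double_false c) (W.eval_double_false d)).trans
      (disjointness_comp_snd _ _)

theorem sd_double_true : (W.double true).sd = W.sd ^ 2 := by
  rw [sd, SD_double_true, statDiff_xorProd, ← SD_eq_statDiff, ← pow_two, ← sd]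

theorem sd_double_false_le : (W.double false).sd ≤ 2 * W.sd := by
  rw [sd, SD_double_false]
  refine statDiff_prodMap_le.trans_eq ?_
  rw [← SD_eq_statDiff, ← two_mul, ← sd]

theorem sq_disj_le_disj_double_true : W.disj ^ 2 ≤ (W.double true).disj := by
  have disj_le_left : W.disj ≤ Disj (W.circuit false) (W.circuit true) := min_le_left _ _
  have disj_le_right : W.disj ≤ Disj (W.circuit true) (W.circuit false) := min_le_right _ _
  have disj_nonneg : 0 ≤ W.disj := mutDisj_nonneg _ _
  have le_Disj (c : Bool) :
      W.disj ^ 2 ≤ Disj ((W.double true).circuit c) ((W.double true).circuit !c) := by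
    rw [Disj_double_true]
    refine le_trans ?_ (le_disjointness_xorProd c)
    simp only [← Disj_eq_disjointness]
    cases c <;> simp only [Bool.not_false, Bool.not_true] <;> nlinarith
  exact le_min (le_Disj false) (le_Disj true)

theorem one_sub_disj_double_false_le : 1 - (W.double false).disj ≤ (1 - W.disj) ^ 2 := by
  have le_Disj (c d : Bool) (disj_le : W.disj ≤ Disj (W.circuit c) (W.circuit d)) :
      1 - (1 - W.disj) ^ 2 ≤ Disj ((W.double false).circuit c) ((W.double false).circuit d) := by
    have Disj_le_one := Disj_le_one (W.circuit c) (W.circuit d)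
    rw [Disj_double_false, ← sub_sub_cancel 1 (disjointness _ _), one_sub_disjointness_prodMap,
      ← Disj_eq_disjointness, ← pow_two]
    gcongr
  rw [sub_le_comm]
  exact le_min (le_Disj false true (min_le_left _ _)) (le_Disj true false (min_le_right _ _))

theorem sd_iterate_double_true (h : ℕ) : ((double true)^[h] W).sd = W.sd ^ 2 ^ h := by
  induction h generalizing W with
  | zero => simp
  | succ h ih => rw [Function.iterate_succ_apply, ih, sd_double_true, ← pow_mul, pow_succ']

theorem sd_iterate_double_false_le (j : ℕ) : ((double false)^[j] W).sd ≤ 2 ^ j * W.sd := by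
  induction j generalizing W with
  | zero => simp
  | succ j ih =>
    grw [Function.iterate_succ_apply, ih, sd_double_false_le, pow_succ, mul_assoc]

theorem pow_disj_le_disj_iterate_double_true (h : ℕ) :
    W.disj ^ 2 ^ h ≤ ((double true)^[h] W).disj := by
  induction h generalizing W with
  | zero => simp
  | succ h ih =>
    grw [Function.iterate_succ_apply, ← ih, ← sq_disj_le_disj_double_true, ← pow_mul, pow_succ']

theorem one_sub_disj_iterate_double_false_le (j : ℕ) :
    1 - ((double false)^[j] W).disj ≤ (1 - W.disj) ^ 2 ^ j := by
  induction j generalizing W with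
  | zero => simp
  | succ j ih =>
    grw [Function.iterate_succ_apply, ih, one_sub_disj_double_false_le, ← pow_mul, pow_succ']
    exact sub_nonneg.2 (mutDisj_le_one _ _)

end SelectorCircuit

namespace SelectorCircuit

/-- A round that doubles the exponent of the error also halves the counter. -/
theorem amplifyStep_iterate_le {f : SelectorCircuit → ℝ}
    (le_sq : ∀ W u, 0 ≤ u → u ≤ 1 → f W ≤ u / 4 → f ((W.double true).double false) ≤ u ^ 2 / 4)
    {W : SelectorCircuit} {u : ℝ} (u_nonneg : 0 ≤ u) (u_le_one : u ≤ 1) (le_u : f W ≤ u / 4)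
    {c i : ℕ} (c_le : c ≤ i) : f (amplifyStep^[i] (W, c)).1 ≤ u ^ (c + 1) / 4 := by
  induction i generalizing W u c with
  | zero => simpa [Nat.le_zero.1 c_le] using le_u
  | succ i ih =>
    cases c with
    | zero => simpa [Function.iterate_fixed (f := amplifyStep) (x := (W, 0)) rfl] using le_u
    | succ c =>
      calc f (amplifyStep^[i] ((W.double true).double false, (c + 1) / 2)).1
        _ ≤ (u ^ 2) ^ ((c + 1) / 2 + 1) / 4 := ih (sq_nonneg u) (pow_le_one₀ u_nonneg u_le_one)
          (le_sq W u u_nonneg u_le_one le_u) (by omega)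
        _ ≤ u ^ (c + 1 + 1) / 4 := by
          rw [← pow_mul]
          gcongr ?_ / 4
          exact pow_le_pow_of_le_one u_nonneg u_le_one (by omega)

theorem amplifyStep_iterate_le_one_div_two_pow {f : SelectorCircuit → ℝ}
    (le_sq : ∀ W u, 0 ≤ u → u ≤ 1 → f W ≤ u / 4 → f ((W.double true).double false) ≤ u ^ 2 / 4)
    {W : SelectorCircuit} (le : f W ≤ 1 / 8) (k : ℕ) :
    f (amplifyStep^[k] (W, k)).1 ≤ 1 / 2 ^ k :=
  calc f (amplifyStep^[k] (W, k)).1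
    _ ≤ (1 / 2) ^ (k + 1) / 4 :=
      amplifyStep_iterate_le le_sq (by norm_num) (by norm_num) (by linarith) le_rfl
    _ = 1 / 2 ^ k * (1 / 8) := by rw [pow_succ, one_div_pow]; ring
    _ ≤ 1 / 2 ^ k := mul_le_of_le_one_right (by positivity) (by norm_num)

theorem sd_double_double_le (W : SelectorCircuit) {u : ℝ} (le_u : W.sd ≤ u / 4) :
    ((W.double true).double false).sd ≤ u ^ 2 / 4 := by
  have sd_nonneg : 0 ≤ W.sd := SD_nonneg _ _
  grw [sd_double_false_le, sd_double_true]
  nlinarith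

theorem one_sub_disj_double_double_le (W : SelectorCircuit) {u : ℝ} (u_nonneg : 0 ≤ u)
    (u_le_one : u ≤ 1) (le_u : 1 - W.disj ≤ u / 4) :
    1 - ((W.double true).double false).disj ≤ u ^ 2 / 4 := by
  have error_nonneg : 0 ≤ 1 - (W.double true).disj := sub_nonneg.2 (mutDisj_le_one _ _)
  have error_le : 1 - (W.double true).disj ≤ u / 2 := by
    grw [← sq_disj_le_disj_double_true]
    nlinarith
  grw [one_sub_disj_double_false_le, error_le]
  exact le_of_eq (by ring)

end SelectorCircuit

section SeparatingPowers

theorem one_sub_pow_le {y : ℝ} (y_nonneg : 0 ≤ y) (y_le_one : y ≤ 1) (n : ℕ) :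
    (1 - y) ^ n ≤ 1 / (1 + n * y) := by
  rw [le_div_iff₀ (by positivity)]
  calc (1 - y) ^ n * (1 + n * y)
    _ ≤ (1 - y) ^ n * (1 + y) ^ n := mul_le_mul_of_nonneg_left
      (one_add_mul_le_pow (by linarith) n) (pow_nonneg (sub_nonneg.2 y_le_one) n)
    _ = (1 - y ^ 2) ^ n := by rw [← mul_pow]; ring
    _ ≤ 1 := pow_le_one₀ (by nlinarith) (by nlinarith)

/-- For a large ratio `b ^ 2 ^ h / a ^ 2 ^ h`, some power of two lies well between the inverses of
the two powers. -/
theorem exists_separating_powers_of_pos {a b ε : ℝ} (a_pos : 0 < a) (a_lt_b : a < b)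
    (b_le_one : b ≤ 1) (ε_pos : 0 < ε) :
    ∃ h j : ℕ, 2 ^ j * a ^ 2 ^ h ≤ ε ∧ (1 - b ^ 2 ^ h) ^ 2 ^ j ≤ ε := by
  have one_lt_ratio : 1 < b / a := (one_lt_div a_pos).2 a_lt_b
  obtain ⟨h, lt_ratio⟩ := pow_unbounded_of_one_lt (2 / ε ^ 2 + 1 / ε) one_lt_ratio
  have ratio_le : 2 / ε ^ 2 + 1 / ε ≤ b ^ 2 ^ h / a ^ 2 ^ h := by
    rw [← div_pow]
    exact lt_ratio.le.trans (pow_le_pow_right₀ one_lt_ratio.le Nat.lt_two_pow_self.le)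
  have A_pos : 0 < a ^ 2 ^ h := by positivity
  have B_pos : 0 < b ^ 2 ^ h := pow_pos (a_pos.trans a_lt_b) _
  have B_le_one : b ^ 2 ^ h ≤ 1 := pow_le_one₀ (a_pos.trans a_lt_b).le b_le_one
  refine ⟨h, ?_⟩
  generalize a ^ 2 ^ h = A, b ^ 2 ^ h = B at *
  have A_le : A ≤ ε := by
    have : 1 / ε ≤ B / A := le_of_add_le_of_nonneg_right ratio_le (by positivity)
    rw [div_le_div_iff₀ ε_pos A_pos] at this
    nlinarith
  obtain ⟨j, pow_le, lt_pow⟩ := exists_nat_pow_near ((one_le_div A_pos).2 A_le) one_lt_two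
  refine ⟨j, (le_div_iff₀ A_pos).1 pow_le, ?_⟩
  have inv_le : 1 / ε ≤ 2 ^ j * B := by
    have : 2 / ε ^ 2 ≤ B / A := le_of_add_le_of_nonneg_left ratio_le (by positivity)
    calc 1 / ε = 2 / ε ^ 2 * (ε / 2) := by field_simp
      _ ≤ B / A * (ε / 2) := by gcongr
      _ = ε / A * (B / 2) := by ring
      _ ≤ 2 ^ (j + 1) * (B / 2) := by gcongr
      _ = 2 ^ j * B := by ring
  calc (1 - B) ^ 2 ^ j ≤ 1 / (1 + (2 ^ j : ℕ) * B) := one_sub_pow_le B_pos.le B_le_one _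
    _ ≤ 1 / (1 / ε) := by
      gcongr
      push_cast
      linarith
    _ = ε := one_div_one_div ε

theorem exists_separating_powers {a b ε : ℝ} (a_nonneg : 0 ≤ a) (a_lt_b : a < b)
    (b_le_one : b ≤ 1) (ε_pos : 0 < ε) :
    ∃ h j : ℕ, 2 ^ j * a ^ 2 ^ h ≤ ε ∧ (1 - b ^ 2 ^ h) ^ 2 ^ j ≤ ε := by
  obtain ⟨a', a_lt, a'_lt⟩ := exists_between a_lt_b
  obtain ⟨h, j, le_left, le_right⟩ :=
    exists_separating_powers_of_pos (a_nonneg.trans_lt a_lt) a'_lt b_le_one ε_pos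
  refine ⟨h, j, le_trans ?_ le_left, le_right⟩
  gcongr

end SeparatingPowers

namespace CircuitPair

open SelectorCircuit

variable {h j : ℕ} {P : CircuitPair}

theorem sd_selector (P : CircuitPair) : P.selector.sd = SD P.X P.Y := by
  simp only [sd, SD_eq_statDiff, eval_selector, cond_false, cond_true]
  rfl

theorem disj_selector (P : CircuitPair) : P.selector.disj = mutDisj P.X P.Y := by
  simp only [disj, mutDisj, Disj_eq_disjointness, eval_selector, cond_false, cond_true]
  rfl

theorem SD_polarize_le (le : 2 ^ j * SD P.X P.Y ^ 2 ^ h ≤ 1 / 8) (k : ℕ) :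
    SD (polarize h j (P, k)).X (polarize h j (P, k)).Y ≤ 1 / 2 ^ k := by
  refine amplifyStep_iterate_le_one_div_two_pow (f := sd)
    (fun W _ _ _ => W.sd_double_double_le) ?_ k
  grw [sd_iterate_double_false_le, sd_iterate_double_true, sd_selector, le]

theorem le_mutDisj_polarize (le : (1 - mutDisj P.X P.Y ^ 2 ^ h) ^ 2 ^ j ≤ 1 / 8) (k : ℕ) :
    1 - 1 / 2 ^ k ≤ mutDisj (polarize h j (P, k)).X (polarize h j (P, k)).Y := by
  rw [sub_le_comm]
  refine amplifyStep_iterate_le_one_div_two_pow (f := fun W => 1 - W.disj)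
    (fun W _ => W.one_sub_disj_double_double_le) ?_ k
  grw [one_sub_disj_iterate_double_false_le, ← pow_disj_le_disj_iterate_double_true, disj_selector,
    le]
  exact sub_nonneg.2 (mutDisj_le_one _ _)

theorem exists_mapsInstances_polarize {a b : ℝ} (a_nonneg : 0 ≤ a) (a_lt_b : a < b)
    (b_le_one : b ≤ 1) : ∃ h j : ℕ, ∀ k : ℕ, MapsInstances (mutIID a b)
      (mutIID (1 / 2 ^ k) (1 - 1 / 2 ^ k)) fun P => polarize h j (P, k) := by
  obtain ⟨h, j, le_left, le_right⟩ :=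
    exists_separating_powers a_nonneg a_lt_b b_le_one (ε := 1 / 8) (by norm_num)
  refine ⟨h, j, fun k => ⟨fun P SD_le => SD_polarize_le (le_trans ?_ le_left) k,
    fun P le_mutDisj => le_mutDisj_polarize (le_trans ?_ le_right) k⟩⟩
  · have := SD_nonneg P.X P.Y
    gcongr
    exact SD_le
  · have : 0 ≤ 1 - mutDisj P.X P.Y ^ 2 ^ h :=
      sub_nonneg.2 (pow_le_one₀ (mutDisj_nonneg _ _) (mutDisj_le_one _ _))
    have b_pos := a_nonneg.trans_lt a_lt_b
    gcongr
    exact le_mutDisj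

end CircuitPair

section ConstantReductions

/-- The circuit without inputs whose only output is `c`. -/
def constCircuit (c : Bool) : Circuit 0 1 where
  nodes := [.const c]
  outputs _ := 0
  preds_lt j hj := by simp [Node.preds]
  outputs_lt _ := Nat.one_pos

theorem mutDisj_constCircuit : mutDisj (constCircuit false) (constCircuit true) = 1 := by
  have Disj_eq_one (c : Bool) : Disj (constCircuit c) (constCircuit !c) = 1 := by
    have eval_ne (x y : Fin 0 → Bool) : (constCircuit c).eval x ≠ (constCircuit !c).eval y := by
      cases c <;> simp [constCircuit, Circuit.eval, Circuit.values, Node.eval, funext_iff]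
    simp [Disj, eval_ne]
  exact (congrArg₂ min (Disj_eq_one false) (Disj_eq_one true)).trans (min_self 1)

theorem mapsInstances_of_one_lt {a b a' b' : ℝ} (one_lt_b : 1 < b) (a'_nonneg : 0 ≤ a') :
    MapsInstances (mutIID a b) (mutIID a' b')
      fun _ => ⟨0, 1, constCircuit false, constCircuit false⟩ := by
  refine ⟨fun P _ => (SD_self _).trans_le a'_nonneg, fun P le_mutDisj => ?_⟩
  exact absurd (one_lt_b.trans_le le_mutDisj) (mutDisj_le_one _ _).not_gt

theorem mapsInstances_of_neg {a b a' b' : ℝ} (a_neg : a < 0) (b'_le_one : b' ≤ 1) :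
    MapsInstances (mutIID a b) (mutIID a' b')
      fun _ => ⟨0, 1, constCircuit false, constCircuit true⟩ := by
  refine ⟨fun P SD_le => ?_, fun P _ => b'_le_one.trans mutDisj_constCircuit.ge⟩
  exact absurd (SD_le.trans_lt a_neg) (SD_nonneg _ _).not_gt

theorem reducesUniformly_and_reduces_of_const {P : PromiseProblem CircuitPair}
    {Q : ℕ → PromiseProblem CircuitPair} {I : CircuitPair}
    (maps : ∀ k, MapsInstances P (Q k) fun _ => I) :
    ReducesUniformly P Q ∧ ∀ k, Reduces P (Q k) :=
  ⟨⟨_, StackProgram.polyTime_const _ _ I, maps⟩,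
    fun k => ⟨_, StackProgram.polyTime_const _ _ I, maps k⟩⟩

end ConstantReductions

theorem mainTheorem4 (a b : ℝ) (hab : a < b) :
    ReducesUniformly (mutIID a b) (fun k => mutIID (1 / 2 ^ k) (1 - 1 / 2 ^ k)) ∧
      ∀ k : ℕ, Reduces (mutIID a b) (mutIID (1 / 2 ^ k) (1 - 1 / 2 ^ k)) := by
  have error_nonneg (k : ℕ) : (0 : ℝ) ≤ 1 / 2 ^ k := by positivity
  rcases lt_or_ge 1 b with one_lt_b | b_le_one
  · exact reducesUniformly_and_reduces_of_const fun k =>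
      mapsInstances_of_one_lt one_lt_b (error_nonneg k)
  rcases lt_or_ge a 0 with a_neg | a_nonneg
  · exact reducesUniformly_and_reduces_of_const fun k =>
      mapsInstances_of_neg a_neg (sub_le_self 1 (error_nonneg k))
  obtain ⟨h, j, maps⟩ := CircuitPair.exists_mapsInstances_polarize a_nonneg hab b_le_one
  exact ⟨⟨_, Program.polyTime_polarize h j, maps⟩,
    fun k => ⟨_, Program.polyTime_polarize_const h j k, maps k⟩⟩
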